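/- Let $p\in\mathbb N$ and let $\mu=(\mu^{i,j})_{1\le i,j\le p}$ be a matrix of locally finite measures on $[0,\infty)$. Put $\mathcal L\mu(z)=\big(\int e^{-zx}\,\mu^{i,j}(dx)\big)_{i,j}$ for $z$ in $\mathcal D=\{z\in\mathbb C:\int e^{-\mathrm{Re}(z)x}\,\mu^{i,j}(dx)<\infty\text{ for all }i,j\}$. Let $\mu^{*n}$ be the $n$-th matrix convolution power ($\mu^{*0}=I\,\delta_0$), and let $U=\sum_{n\ge0}\mu^{*n}$, $U(t)=U([0,t])$. Set $$\Lambda=\{\lambda\in\mathcal D:\det(I-\mathcal L\mu(\lambda))=0\},\qquad \Lambda_\vartheta=\{\lambda\in\Lambda:\mathrm{Re}(\lambda)>\vartheta\}.$$ For $\lambda\in\Lambda$ let $\kappa(\lambda)$ be the smallest natural number such that all entries of $(z-\lambda)^{\kappa(\lambda)}(I-\mathcal L\mu(z))^{-1}$ extend holomorphically to a neighbourhood of $\lambda$, and let $\kappa(\lambda)=0$ for $\lambda\notin\Lambda$. Theorem. Let $\vartheta\in\mathbb R$ and suppose that 1. $\vartheta$ is an interior point of $\mathcal D$; 2. the spectral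 radius of $\mu(\{0\})=(\mu^{i,j}(\{0\}))_{i,j}$ is smaller than $1$; 3. $I-\mathcal L\mu(\vartheta+i\eta)$ is invertible for every $\eta\in\mathbb R$ and $\sup_{\eta\in\mathbb R}\|(I-\mathcal L\mu(\vartheta+i\eta))^{-1}\|<\infty$; 4. $\Lambda_\vartheta$ is finite. Then $U(t)$ has finite entries for every $t$, and there are complex $p\times p$ matrices $C_{\lambda,k}$ ($\lambda\in\Lambda_\vartheta$, $0\le k<\kappa(\lambda)$) and a real $p\times p$ matrix $C_{0,\kappa(0)}$ such that, entry by entry, $$U(t)=\sum_{\lambda\in\Lambda_\vartheta}e^{\lambda t}\sum_{k=0}^{\kappa(\lambda)-1}t^kC_{\lambda,k}+t^{\kappa(0)}C_{0,\kappa(0)}+O(te^{\vartheta t})\qquad(t\to\infty).$$ Moreover $C_{\overline\lambda,k}=\overline{C_{\lambda,k}}$ (so $C_{\lambda,k}$ is real if $\lambda$ is real). For each $\lambda\in\Lambda_\vartheta$ there is an expansion $(I-\mathcal L\mu(z))^{-1}=\sum_{k=1}^{\kappa(\lambda)}A_{\lambda,k}(z-\lambda)^{-k}+H_\lambda(z)$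 near $\lambda$ with $H_\lambda$ holomorphic at $\lambda$, and if $\lambda\neq0$ then $$C_{\lambda,k}=\frac1{k!}\sum_{n=0}^{\kappa(\lambda)-1-k}\frac{(-1)^n}{\lambda^{n+1}}A_{\lambda,n+k+1},\qquad 0\le k<\kappa(\lambda).$$ If $\vartheta<0$, there is such an expansion at $\lambda=0$ as well (also if $0\notin\Lambda$), and, with $A_{0,0}=H_0(0)$, $C_{0,k}=\frac1{k!}A_{0,k}$ for $0\le k\le\kappa(0)$. -/

import Mathlib

open MeasureTheory Filter Topology Asymptotics
open scoped NNReal ENNReal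

noncomputable section

namespace MarkovRenewal

variable {p : ℕ}

/-- A `p × p` matrix of measures on `[0, ∞)`. -/
abbrev MeasureMatrix (p : ℕ) : Type := Fin p → Fin p → Measure ℝ≥0

/-- Matrix convolution: `(μ * ν)^{i,j} = ∑ₖ μ^{i,k} * ν^{k,j}`. -/
def conv (μ ν : MeasureMatrix p) : MeasureMatrix p :=
  fun i j => ∑ k, Measure.conv (μ i k) (ν k j)

/-- Convolution powers `μ^{*n}`; `μ^{*0}` has `δ₀` on the diagonal and `0` off the diagonal. -/
def convPow (μ : MeasureMatrix p) : ℕ → MeasureMatrix p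
  | 0 => fun i j => if i = j then Measure.dirac 0 else 0
  | n + 1 => conv μ (convPow μ n)

/-- The Markov renewal measure `U = ∑ₙ μ^{*n}`. -/
def renewalMeasure (μ : MeasureMatrix p) : MeasureMatrix p :=
  fun i j => Measure.sum fun n => convPow μ n i j

/-- The Markov renewal function `U(t) = U([0,t])`, with values in `[0, ∞]`. -/
def renewalFunction (μ : MeasureMatrix p) (t : ℝ) (i j : Fin p) : ℝ≥0∞ :=
  renewalMeasure μ i j {x : ℝ≥0 | (x : ℝ) ≤ t}

/-- The domain of absolute convergence of the Laplace transform of `μ`. -/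
def laplaceDomain (μ : MeasureMatrix p) : Set ℂ :=
  {z | ∀ i j, ∫⁻ x : ℝ≥0, ENNReal.ofReal (Real.exp (-z.re * (x : ℝ))) ∂(μ i j) < ∞}

/-- The matrix Laplace transform, `(ℒμ(z))^{i,j} = ∫ e^{-zx} μ^{i,j}(dx)`. -/
def laplace (μ : MeasureMatrix p) (z : ℂ) : Matrix (Fin p) (Fin p) ℂ :=
  Matrix.of fun i j => ∫ x : ℝ≥0, Complex.exp (-z * ((x : ℝ) : ℂ)) ∂(μ i j)

/-- The matrix `μ(0) = (μ^{i,j}({0}))` of masses at the origin. -/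
def massAtZero (μ : MeasureMatrix p) : Matrix (Fin p) (Fin p) ℂ :=
  Matrix.of fun i j => ((((μ i j) {0}).toReal : ℝ) : ℂ)

/-- `z ↦ (I - ℒμ(z))⁻¹`, meaningful where `det (I - ℒμ(z)) ≠ 0`. -/
def laplaceResolvent (μ : MeasureMatrix p) (z : ℂ) : Matrix (Fin p) (Fin p) ℂ :=
  (1 - laplace μ z)⁻¹

/-- The set `Λ` of all roots of the characteristic equation `det (I - ℒμ(z)) = 0`. -/
def roots (μ : MeasureMatrix p) : Set ℂ :=
  {z | z ∈ laplaceDomain μ ∧ (1 - laplace μ z).det = 0}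

/-- The set `Λ_θ` of characteristic roots with real part larger than `θ`. -/
def rootsAbove (μ : MeasureMatrix p) (θ : ℝ) : Set ℂ :=
  {z | z ∈ roots μ ∧ θ < z.re}

open scoped Matrix.Norms.Operator in
/-- `I - ℒμ` is invertible on the vertical line with real part `θ`, and
`sup_η ‖(I - ℒμ(θ + iη))⁻¹‖ < ∞`. -/
def ResolventBoundedOnLine (μ : MeasureMatrix p) (θ : ℝ) : Prop :=
  (∀ η : ℝ, (1 - laplace μ ((θ : ℂ) + (η : ℂ) * Complex.I)).det ≠ 0) ∧
  BddAbove (Set.range fun η : ℝ => ‖laplaceResolvent μ ((θ : ℂ) + (η : ℂ) * Complex.I)‖)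

open scoped Classical in
/-- The pole order of `(I - ℒμ)⁻¹` at `z`: for `z ∈ Λ` the smallest `n` such that all entries of
`(w - z)ⁿ (I - ℒμ(w))⁻¹` are (extend to be) holomorphic near `z`, and `0` for `z ∉ Λ`. -/
def poleOrder (μ : MeasureMatrix p) (z : ℂ) : ℕ :=
  if z ∈ roots μ then
    sInf {n : ℕ | ∃ G : ℂ → Matrix (Fin p) (Fin p) ℂ,
      (∀ i j, AnalyticAt ℂ (fun w => G w i j) z) ∧
      ∀ᶠ w in 𝓝[≠] z, (w - z) ^ n • laplaceResolvent μ w = G w}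
  else 0

/-- Near `z`, `F(w) = A m (w - z)^{-m} + ... + A 1 (w - z)^{-1} + H(w)` with `H` holomorphic at
`z` and `H(z) = A 0`. So `A k` is the Laurent coefficient of `(w - z)^{-k}`, `0 ≤ k ≤ m`. -/
def IsLaurentExpansion (F : ℂ → Matrix (Fin p) (Fin p) ℂ) (z : ℂ) (m : ℕ)
    (A : ℕ → Matrix (Fin p) (Fin p) ℂ) : Prop :=
  ∃ H : ℂ → Matrix (Fin p) (Fin p) ℂ,
    (∀ i j, AnalyticAt ℂ (fun w => H w i j) z) ∧ H z = A 0 ∧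
    ∀ᶠ w in 𝓝[≠] z, F w = ∑ k ∈ Finset.Icc 1 m, ((w - z) ^ k)⁻¹ • A k + H w

end MarkovRenewal

end

/-! Far to the right the transform of `U` is the Neumann series `∑ (ℒμ)ⁿ = (I - ℒμ)⁻¹`: `ℒμ(s)`
tends to `μ({0})` as `s → ∞`, whose spectral radius is below one. Hence `U(t)` has transform `(I -
ℒμ(z))⁻¹ / z`, which continues meromorphically to a half-plane slightly larger than `Re z ≥ ϑ`, with
poles there at most at the roots and at `0`. Since `t^k e^{λt}` has transform `k! / (z - λ)^{k+1}`,
the principal parts dictate the coefficients: partial fractions of `(z - λ)^{-q} / z` give `C_{λ,k}`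
for `λ ≠ 0`. At `0` the division by `z` only shifts the Laurent coefficients by one place, hence the
extra term `t^{κ(0)}`.

It remains to see that a difference of transforms, holomorphic on a strip, forces a small remainder.
Two points carry this.

Resolvent bound. By Cramer's rule it is enough to bound `f = det (I - ℒμ)` below. This holds on `Re
z = ϑ` by assumption and on a line `Re z = c` far to the right, where the inverse is the bounded
transform of `U`. A Schwarz estimate carries the bound a little to the left of `ϑ`; between the
lines, above all the finitely many zeros, `log f` exists on discs and the Borel-Carathéodory
inequality bounds it (`exists_strip_lower_bound`, `exists_resolvent_bound`). So the contour can be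
moved to some `a < ϑ`.

Tauberian step. The difference decays only like `|Im z|⁻¹`, too slowly for inversion, and `U` may
jump. Its antiderivative has transform `O(|Im z|⁻²)`, and inversion on `Re z = a` bounds increments
over length `h` by `e^{at} h^s` for every `s < 1` (`exists_increment_bound`). As `U` is monotone,
averages over `[t - h, t]` and `[t, t + h]` enclose `U(t)`; with `h` exponentially small and `s`
close to `1` the loss fits into `e^{(ϑ - a)t}` (`monotone_isBigO_of_increment_bound`). The remainder
obtained is `O(e^{ϑt})`. -/

namespace MarkovRenewal

/-! ### Laplace inversion, contour shift and transforms of cumulative functions -/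

section InverseLaplace

open Complex in
/-- **Laplace inversion** on the vertical line `Re z = c`. -/
theorem laplace_inversion {f : ℝ → ℂ} {c t : ℝ}
    (hfi : Integrable fun x : ℝ => cexp (-(c : ℂ) * x) * f x)
    (hFi : Integrable fun η : ℝ => ∫ x : ℝ, cexp (-(c + η * I) * x) * f x)
    (hf : ContinuousAt f t) :
    f t = (2 * Real.pi : ℂ)⁻¹ *
      ∫ η : ℝ, cexp ((c + η * I) * t) * ∫ x : ℝ, cexp (-(c + η * I) * x) * f x := by
  set g : ℝ → ℂ := fun x => cexp (-(c : ℂ) * x) * f x with hg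
  set F : ℝ → ℂ := fun η => ∫ x : ℝ, cexp (-(c + η * I) * x) * f x with hF
  have h2π : (2 * Real.pi : ℝ) ≠ 0 := by positivity
  -- The Fourier kernel is `e^{-2πi xξ}`, so the vertical line is parametrised by `η = 2πξ`; this is
  -- the source of the factor `(2π)⁻¹`.
  have hfour : FourierTransform.fourier g = fun ξ : ℝ => F (2 * Real.pi * ξ) := by
    funext ξ
    rw [Real.fourier_eq' g ξ]
    simp only [hF, hg, smul_eq_mul]
    congr 1
    funext x
    rw [← mul_assoc, ← Complex.exp_add]
    congr 2
    simp
    ring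
  have hgi : Integrable (FourierTransform.fourier g) := by
    rw [hfour]
    exact hFi.comp_mul_left' h2π
  have hgc : ContinuousAt g t := by
    apply ContinuousAt.mul _ hf
    fun_prop
  have hinv := hfi.fourierInv_fourier_eq hgi hgc
  rw [hfour, Real.fourierInv_eq'] at hinv
  have hft : f t = cexp (c * t) * g t := by
    simp only [hg]
    rw [← mul_assoc, ← Complex.exp_add]
    simp
  rw [hft, ← hinv]
  have := Measure.integral_comp_mul_left
    (fun η : ℝ => cexp ((c + η * I) * t) * F η) (2 * Real.pi)
  rw [abs_of_nonneg (by positivity)] at this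
  have h3 : ((2 * Real.pi : ℂ)⁻¹) * ∫ η : ℝ, cexp ((c + η * I) * t) * F η =
      (2 * Real.pi : ℝ)⁻¹ • ∫ η : ℝ, cexp ((c + η * I) * t) * F η := by
    rw [Complex.real_smul]; push_cast; rfl
  rw [h3, ← this, ← integral_const_mul]
  congr 1
  funext x
  simp only [smul_eq_mul]
  rw [← mul_assoc, ← Complex.exp_add]
  congr 2
  simp
  ring

open Complex in
/-- Shift of a vertical contour of integration for a function with quadratic decay. -/
theorem integral_vertical_line_eq {G : ℂ → ℂ} {a b C r : ℝ} (hab : a ≤ b) (hr : 1 < r)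
    (hG : DifferentiableOn ℂ G {z | a ≤ z.re ∧ z.re ≤ b})
    (hbd : ∀ z : ℂ, a ≤ z.re → z.re ≤ b → ‖G z‖ ≤ C * (1 + z.im ^ 2) ^ (-r / 2)) :
    ∫ η : ℝ, G (a + η * I) = ∫ η : ℝ, G (b + η * I) := by
  have hint : Integrable (fun η : ℝ => C * ((1 : ℝ) + η ^ 2) ^ (-r / 2)) := by
    have := integrable_rpow_neg_one_add_norm_sq (E := ℝ) (μ := volume) (r := r) (by simpa using hr)
    simpa using this.const_mul C
  have hline : ∀ s : ℝ, a ≤ s → s ≤ b → Integrable fun η : ℝ => G (s + η * I) := by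
    intro s hs1 hs2
    refine hint.mono' ?_ (Eventually.of_forall fun η => ?_)
    · apply Continuous.aestronglyMeasurable
      refine hG.continuousOn.comp_continuous (by fun_prop) ?_
      intro x; simp [hs1, hs2]
    · simpa using hbd (s + η * I) (by simpa using hs1) (by simpa using hs2)
  have hlim : ∀ s : ℝ, a ≤ s → s ≤ b → Tendsto (fun T : ℝ => ∫ η in (-T)..T, G (s + η * I)) atTop
      (𝓝 (∫ η : ℝ, G (s + η * I))) := fun s h1 h2 =>
    intervalIntegral_tendsto_integral (hline s h1 h2) tendsto_neg_atTop_atBot tendsto_id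
  have hdecay : Tendsto (fun T : ℝ => C * ((1 : ℝ) + T ^ 2) ^ (-r / 2) * (b - a)) atTop (𝓝 0) := by
    have h1 : Tendsto (fun T : ℝ => (1 : ℝ) + T ^ 2) atTop atTop :=
      tendsto_atTop_add_const_left _ _ (tendsto_pow_atTop two_ne_zero)
    have h2 := (tendsto_rpow_neg_atTop (y := r / 2) (by linarith)).comp h1
    have h3 := (h2.const_mul C).mul_const (b - a)
    simp only [mul_zero, zero_mul, neg_div] at h3 ⊢
    exact h3
  have hhor : ∀ T : ℝ, ‖∫ x in a..b, G (x + T * I)‖ ≤ C * ((1 : ℝ) + T ^ 2) ^ (-r / 2) * (b - a) := by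
    intro T
    have := intervalIntegral.norm_integral_le_of_norm_le_const
      (f := fun x : ℝ => G (x + T * I)) (a := a) (b := b)
      (C := C * ((1 : ℝ) + T ^ 2) ^ (-r / 2)) ?_
    · rwa [abs_of_nonneg (by linarith)] at this
    · intro x hx
      rw [Set.uIoc_of_le hab] at hx
      simpa using hbd (x + T * I) (by simpa using hx.1.le) (by simpa using hx.2)
  -- Cauchy's theorem on a rectangle: the two vertical integrals differ by the horizontal sides,
  -- which vanish as `T → ∞`.
  have hrect : ∀ T : ℝ, 0 ≤ T → (∫ η in (-T)..T, G (b + η * I)) - ∫ η in (-T)..T, G (a + η * I) =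
      -I * ((∫ x in a..b, G (x + T * I)) - ∫ x in a..b, G (x + (-T : ℝ) * I)) := by
    intro T hT
    have := integral_boundary_rect_eq_zero_of_differentiableOn G (a + (-T : ℝ) * I) (b + T * I) ?_
    · simp only [add_re, ofReal_re, mul_re, I_re, mul_zero, ofReal_im, I_im, mul_one, sub_self,
        add_zero, add_im, mul_im, zero_add, smul_eq_mul] at this
      have h2 := congrArg (fun w => -I * w) this
      simp only [mul_zero] at h2
      linear_combination h2 + ((∫ η in (-T)..T, G (b + η * I)) - ∫ η in (-T)..T, G (a + η * I)) * I_mul_I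
    · apply hG.mono
      intro z hz
      simp only [add_re, ofReal_re, mul_re, I_re, mul_zero, ofReal_im, I_im, mul_one, sub_self,
        add_zero, add_im, mul_im, zero_add] at hz
      have := hz.1
      simp only [Set.mem_preimage] at this
      rw [Set.uIcc_of_le hab] at this
      exact this
  have hzero : Tendsto (fun T : ℝ => (∫ η in (-T)..T, G (b + η * I)) - ∫ η in (-T)..T, G (a + η * I))
      atTop (𝓝 0) := by
    have hd2 := hdecay.add hdecay
    rw [add_zero] at hd2
    refine squeeze_zero_norm' ?_ hd2
    filter_upwards [eventually_ge_atTop 0] with T hT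
    rw [hrect T hT]
    have h1 := hhor T
    have h2 := hhor (-T)
    rw [neg_sq] at h2
    calc _ ≤ ‖∫ x in a..b, G (x + T * I)‖ + ‖∫ x in a..b, G (x + (-T : ℝ) * I)‖ := by
          rw [norm_mul, norm_neg, norm_I, one_mul]; exact norm_sub_le _ _
      _ ≤ _ := add_le_add h1 h2
  have := tendsto_nhds_unique hzero ((hlim b hab le_rfl).sub (hlim a le_rfl hab))
  exact (sub_eq_zero.mp this.symm).symm

open Complex in
/-- The Laplace transform of `t ↦ ∫_{[0,t]} f dν`. -/
theorem laplace_cumulative {ν : Measure ℝ} [SFinite ν] {f : ℝ → ℂ} {z : ℂ} (hz : 0 < z.re)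
    (hf : Integrable (fun x : ℝ => cexp (-z * x) * f x) ν) :
    Integrable (fun t : ℝ => cexp (-z * t) * ∫ x in Set.Iic t, f x ∂ν) ∧
    ∫ t : ℝ, cexp (-z * t) * ∫ x in Set.Iic t, f x ∂ν = (∫ x : ℝ, cexp (-z * x) * f x ∂ν) / z := by
  have hz0 : z ≠ 0 := by rintro rfl; simp at hz
  -- The weighted cumulative function is the convolution of `K` with `e^{-zx} f dν`, so Fubini
  -- produces the factor `∫ K = 1/z`. The closed half-line makes an atom of `ν` at `x = t` count.
  set K : ℝ → ℂ := (Set.Ici (0:ℝ)).indicator fun s => cexp (-z * s) with hK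
  have hKi : Integrable K := by
    rw [hK, integrable_indicator_iff measurableSet_Ici, integrableOn_Ici_iff_integrableOn_Ioi]
    exact integrableOn_exp_mul_complex_Ioi (by simpa using hz) 0
  have hKint : ∫ s, K s = 1 / z := by
    rw [hK, integral_indicator measurableSet_Ici, integral_Ici_eq_integral_Ioi,
      integral_exp_mul_complex_Ioi (by simpa using hz) 0]
    simp [neg_div]
  -- the kernel `(t, x) ↦ K (t - x) e^{-zx} f x`
  have hker : ∀ t x : ℝ, K (t - x) * (cexp (-z * x) * f x) =
      cexp (-z * t) * (Set.Iic t).indicator f x := by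
    intro t x
    by_cases h : x ≤ t
    · rw [hK, Set.indicator_of_mem (by simpa using h), Set.indicator_of_mem (by simpa using h),
        ← mul_assoc, ← Complex.exp_add]
      congr 2
      push_cast; ring
    · rw [hK, Set.indicator_of_notMem (by simpa using h), Set.indicator_of_notMem (by simpa using h)]
      simp
  have hKm : Measurable K := by
    rw [hK]; exact Measurable.indicator (by fun_prop) measurableSet_Ici
  have hprod : Integrable (fun q : ℝ × ℝ => K (q.1 - q.2) * (cexp (-z * q.2) * f q.2))
      (volume.prod ν) := by
    have hm : AEStronglyMeasurable (fun q : ℝ × ℝ => K (q.1 - q.2) * (cexp (-z * q.2) * f q.2))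
        (volume.prod ν) := by
      apply AEStronglyMeasurable.mul
      · exact (hKm.comp (measurable_fst.sub measurable_snd)).aestronglyMeasurable
      · exact hf.aestronglyMeasurable.comp_snd
    rw [integrable_prod_iff' hm]
    constructor
    · refine Eventually.of_forall fun x => ?_
      exact (hKi.comp_sub_right x).mul_const (cexp (-z * x) * f x)
    · simp only [norm_mul]
      have : (fun x : ℝ => ∫ t : ℝ, ‖K (t - x)‖ * (‖cexp (-z * x)‖ * ‖f x‖)) =
          fun x : ℝ => (∫ t : ℝ, ‖K t‖) * ‖cexp (-z * x) * f x‖ := by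
        funext x
        rw [integral_mul_const, integral_sub_right_eq_self (fun t => ‖K t‖) x, norm_mul]
      rw [this]
      exact hf.norm.const_mul _
  have hinner : ∀ t : ℝ, ∫ x, K (t - x) * (cexp (-z * x) * f x) ∂ν =
      cexp (-z * t) * ∫ x in Set.Iic t, f x ∂ν := by
    intro t
    simp_rw [hker]
    rw [integral_const_mul, integral_indicator measurableSet_Iic]
  constructor
  · have := hprod.integral_prod_left
    simpa only [hinner] using this
  · have := integral_integral_swap (f := fun t x => K (t - x) * (cexp (-z * x) * f x)) hprod
    simp only [hinner] at this
    rw [this]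
    have h2 : ∀ x : ℝ, ∫ t, K (t - x) * (cexp (-z * x) * f x) = (1 / z) * (cexp (-z * x) * f x) := by
      intro x
      rw [integral_mul_const, integral_sub_right_eq_self (fun t => K t) x, hKint]
    simp_rw [h2]
    rw [integral_const_mul]
    ring

end InverseLaplace

end MarkovRenewal

namespace MarkovRenewal

/-! ### Increments of the antiderivative -/

section Tauberian

-- Interpolates between the linear bound for small `w` and the trivial one for large `w`. With `w =
-- zh` a gain of `h^s` costs only `|z|^s`, which quadratic decay absorbs if `s < 1`.
open Complex in
theorem norm_exp_sub_one_le_rpow {w : ℂ} {R s : ℝ} (hR : 0 ≤ R) (hw : w.re ≤ R) (hs : 0 ≤ s)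
    (hs1 : s ≤ 1) : ‖cexp w - 1‖ ≤ (1 + Real.exp R) * ‖w‖ ^ s := by
  have hexp : (1 : ℝ) ≤ Real.exp R := Real.one_le_exp hR
  rcases le_total ‖w‖ 1 with h | h
  · have h1 : ‖w‖ ≤ ‖w‖ ^ s := by
      rcases (norm_nonneg w).eq_or_lt with h0 | h0
      · rw [← h0]; positivity
      · simpa using Real.rpow_le_rpow_of_exponent_ge h0 h hs1
    calc _ ≤ 2 * ‖w‖ := norm_exp_sub_one_le h
      _ ≤ (1 + Real.exp R) * ‖w‖ := by gcongr; linarith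
      _ ≤ _ := by gcongr
  · have h1 : 1 ≤ ‖w‖ ^ s := Real.one_le_rpow h hs
    calc ‖cexp w - 1‖ ≤ ‖cexp w‖ + ‖(1 : ℂ)‖ := norm_sub_le _ _
      _ ≤ 1 + Real.exp R := by
        rw [Complex.norm_exp, norm_one, add_comm]; gcongr
      _ ≤ _ := le_mul_of_one_le_right (by positivity) h1

open Complex in
theorem inv_norm_le_of_le_re {z : ℂ} {a : ℝ} (ha : 0 < a) (hz : a ≤ z.re) :
    ‖z‖⁻¹ ≤ (1 + a⁻¹) * (1 + z.im ^ 2) ^ (-1 / 2 : ℝ) := by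
  have hz0 : 0 < ‖z‖ := by
    have := (hz.trans (le_abs_self _)).trans (abs_re_le_norm z); linarith
  have h1 : √(1 + z.im ^ 2) ≤ (1 + a⁻¹) * ‖z‖ := by
    apply Real.sqrt_le_iff.mpr
    refine ⟨by positivity, ?_⟩
    rw [mul_pow, Complex.sq_norm, Complex.normSq_apply]
    have h2 : a ^ 2 ≤ z.re ^ 2 := by gcongr
    have h3 : a⁻¹ ^ 2 * a ^ 2 = 1 := by field_simp
    have h4 : 0 < a⁻¹ := by positivity
    nlinarith [mul_le_mul_of_nonneg_left h2 (sq_nonneg a⁻¹), sq_nonneg z.im, sq_nonneg z.re,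
      mul_nonneg h4.le (sq_nonneg z.im), mul_nonneg h4.le (sq_nonneg z.re),
      mul_nonneg (sq_nonneg a⁻¹) (sq_nonneg z.im)]
  rw [neg_div, Real.rpow_neg (by positivity), ← Real.sqrt_eq_rpow, ← div_eq_mul_inv,
    inv_le_comm₀ hz0 (by positivity), inv_div, div_le_iff₀ (by positivity)]
  rwa [mul_comm]

open Complex in
/-- Increments of the antiderivative of a function whose Laplace transform, known on `Re z = c`,
continues analytically to `Re z ≥ a` with decay of order `|Im z|⁻¹`. -/
theorem exists_increment_bound {w : ℝ → ℂ} {D : ℂ → ℂ} {a c C s : ℝ} (ha : 0 < a) (hac : a ≤ c)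
    (hs : 0 < s) (hs1 : s < 1)
    (hw : Integrable fun t : ℝ => cexp (-(c : ℂ) * t) * w t)
    (hD : DifferentiableOn ℂ D {z | a ≤ z.re ∧ z.re ≤ c})
    (hbd : ∀ z : ℂ, a ≤ z.re → z.re ≤ c → ‖D z‖ ≤ C * (1 + z.im ^ 2) ^ (-1 / 2 : ℝ))
    (htr : ∀ η : ℝ, ∫ t : ℝ, cexp (-(c + η * I) * t) * w t = D (c + η * I)) :
    ∃ M : ℝ, ∀ t h : ℝ, 0 < h → h ≤ 1 →
      ‖∫ x in t..(t + h), w x‖ ≤ M * Real.exp (a * t) * h ^ s := by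
  have hc : 0 < c := ha.trans_le hac
  have hC : 0 ≤ C := by
    have := (norm_nonneg _).trans (hbd (a : ℂ) (by simp) (by simpa using hac))
    simpa using this
  set A : ℝ := 1 + a⁻¹ with hA
  have hA1 : 1 ≤ A := by rw [hA]; have : 0 < a⁻¹ := by positivity
                         linarith
  have hwz : ∀ η : ℝ, Integrable fun t : ℝ => cexp (-(c + η * I) * t) * w t := by
    intro η
    have : (fun t : ℝ => cexp (-(c + η * I) * t) * w t) =
        fun t : ℝ => cexp (-(η * I) * t) * (cexp (-(c : ℂ) * t) * w t) := by
      funext t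
      rw [← mul_assoc, ← Complex.exp_add]; congr 2; ring
    rw [this]
    refine hw.bdd_mul (c := 1) (by fun_prop) (Eventually.of_forall fun t => ?_)
    rw [Complex.norm_exp]; simp
  have hwI : ∀ t : ℝ, IntegrableOn w (Set.Iic t) := by
    intro t
    have h1 : IntegrableOn (fun x : ℝ => cexp ((c : ℂ) * x) * (cexp (-(c : ℂ) * x) * w x))
        (Set.Iic t) := by
      refine hw.integrableOn.bdd_mul (c := Real.exp (c * t)) (by fun_prop) ?_
      filter_upwards [ae_restrict_mem measurableSet_Iic] with x hx
      rw [Complex.norm_exp]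
      simp only [mul_re, ofReal_re, ofReal_im, mul_zero, sub_zero]
      gcongr
      exact hx
    refine h1.congr_fun (fun x _ => ?_) measurableSet_Iic
    beta_reduce
    rw [← mul_assoc, ← Complex.exp_add]; simp
  have hII : ∀ x y : ℝ, IntervalIntegrable w volume x y := fun x y =>
    ⟨(hwI y).mono_set Set.Ioc_subset_Iic_self, (hwI x).mono_set Set.Ioc_subset_Iic_self⟩
  -- Integrating divides the transform by `z`, which gives quadratic decay, and makes the function
  -- continuous, so that inversion holds at every `t`.
  set E : ℝ → ℂ := fun t => ∫ x in Set.Iic t, w x with hE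
  have hEdiff : ∀ t h : ℝ, E (t + h) - E t = ∫ x in t..(t + h), w x := fun t h =>
    intervalIntegral.integral_Iic_sub_Iic (hwI t) (hwI _)
  have hEcont : Continuous E := by
    have h1 : E = fun t => E 0 + ∫ x in (0:ℝ)..t, w x := by
      funext t
      have := hEdiff 0 t
      rw [zero_add] at this
      rw [← this]; ring
    rw [h1]
    exact continuous_const.add (intervalIntegral.continuous_primitive hII 0)
  have hcum : ∀ η : ℝ, _ := fun η =>
    laplace_cumulative (ν := volume) (f := w) (z := c + η * I) (by simpa using hc) (hwz η)
  have hEtr : ∀ η : ℝ, ∫ t : ℝ, cexp (-(c + η * I) * t) * E t = D (c + η * I) / (c + η * I) :=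
    fun η => by rw [← htr η]; exact (hcum η).2
  have hz0 : ∀ z : ℂ, a ≤ z.re → z ≠ 0 := by
    rintro z hz rfl; simp at hz; linarith
  have hDz : ∀ z : ℂ, a ≤ z.re → z.re ≤ c → ‖D z / z‖ ≤ C * A * (1 + z.im ^ 2) ^ (-2 / 2 : ℝ) := by
    intro z h1 h2
    rw [norm_div, div_eq_mul_inv]
    calc _ ≤ (C * (1 + z.im ^ 2) ^ (-1 / 2 : ℝ)) * (A * (1 + z.im ^ 2) ^ (-1 / 2 : ℝ)) :=
          mul_le_mul (hbd z h1 h2) (inv_norm_le_of_le_re ha h1) (by positivity) (by positivity)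
      _ = C * A * ((1 + z.im ^ 2) ^ (-1 / 2 : ℝ) * (1 + z.im ^ 2) ^ (-1 / 2 : ℝ)) := by ring
      _ = _ := by rw [← Real.rpow_add (by positivity)]; norm_num
  have hDzd : DifferentiableOn ℂ (fun z => D z / z) {z | a ≤ z.re ∧ z.re ≤ c} :=
    hD.div differentiableOn_id fun z hz => hz0 z hz.1
  have hint : ∀ r : ℝ, 1 < r → Integrable (fun η : ℝ => ((1 : ℝ) + η ^ 2) ^ (-r / 2)) := by
    intro r hr
    simpa using integrable_rpow_neg_one_add_norm_sq (E := ℝ) (μ := volume) (r := r) (by simpa using hr)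
  have hline : ∀ σ : ℝ, a ≤ σ → σ ≤ c →
      Continuous fun η : ℝ => D (σ + η * I) / (σ + η * I) := by
    intro σ h1 h2
    refine hDzd.continuousOn.comp_continuous (f := fun η : ℝ => (σ : ℂ) + η * I) (by fun_prop) ?_
    intro x; simp [h1, h2]
  have hlinei : ∀ σ : ℝ, a ≤ σ → σ ≤ c →
      Integrable fun η : ℝ => D (σ + η * I) / (σ + η * I) := by
    intro σ h1 h2
    refine ((hint 2 one_lt_two).const_mul (C * A)).mono' (hline σ h1 h2).aestronglyMeasurable
      (Eventually.of_forall fun η => ?_)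
    simpa using hDz (σ + η * I) (by simpa using h1) (by simpa using h2)
  -- Inversion on `Re z = c`, then a shift to `Re z = a`; `a > 0` keeps the pole of `1/z` out of the
  -- strip.
  have hEform : ∀ t : ℝ, E t = (2 * Real.pi : ℂ)⁻¹ *
      ∫ η : ℝ, cexp ((a + η * I) * t) * (D (a + η * I) / (a + η * I)) := by
    intro t
    have h1 := laplace_inversion (f := E) (c := c) (t := t) ?_ ?_ hEcont.continuousAt
    · rw [h1]
      simp_rw [hEtr]
      congr 1
      symm
      refine integral_vertical_line_eq (G := fun z => cexp (z * t) * (D z / z)) (r := 2)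
        (C := Real.exp (max (a * t) (c * t)) * (C * A)) hac one_lt_two ?_ ?_
      · exact DifferentiableOn.mul (by fun_prop) hDzd
      · intro z h1 h2
        rw [norm_mul, Complex.norm_exp, mul_assoc]
        gcongr
        · simp only [mul_re, ofReal_re, ofReal_im, mul_zero, sub_zero]
          rcases le_total 0 t with ht | ht
          · exact le_max_of_le_right (by gcongr)
          · exact le_max_of_le_left (mul_le_mul_of_nonpos_right h1 ht)
        · exact hDz z h1 h2
    · simpa using (hcum 0).1
    · simp_rw [hEtr]
      exact hlinei c hac le_rfl
  have hfin : ∀ t : ℝ, Integrable fun η : ℝ =>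
      cexp ((a + η * I) * t) * (D (a + η * I) / (a + η * I)) := by
    intro t
    refine (hlinei a le_rfl hac).bdd_mul (c := Real.exp (a * t)) (by fun_prop)
      (Eventually.of_forall fun η => ?_)
    rw [Complex.norm_exp]; simp
  -- Bounding `(e^{zh} - 1) D(z)/z` leaves the decay exponent `2 - s`, integrable because `s < 1`.
  set J : ℝ := ∫ η : ℝ, ((1 : ℝ) + η ^ 2) ^ (-(2 - s) / 2) with hJ
  refine ⟨(2 * Real.pi)⁻¹ * ((1 + Real.exp a) * C * A * J), fun t h hh hh1 => ?_⟩
  rw [← hEdiff, hEform, hEform, ← mul_sub, ← integral_sub (hfin _) (hfin _), norm_mul]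
  have hpt : ∀ η : ℝ, ‖cexp ((a + η * I) * (t + h : ℝ)) * (D (a + η * I) / (a + η * I)) -
      cexp ((a + η * I) * t) * (D (a + η * I) / (a + η * I))‖ ≤
      ((1 + Real.exp a) * C * A * Real.exp (a * t) * h ^ s) * (1 + η ^ 2) ^ (-(2 - s) / 2) := by
    intro η
    set z : ℂ := a + η * I with hz
    have hre : z.re = a := by simp [hz]
    have him : z.im = η := by simp [hz]
    have hzne : 0 < ‖z‖ := norm_pos_iff.mpr (hz0 z hre.ge)
    have e1 : cexp (z * (t + h : ℝ)) * (D z / z) - cexp (z * t) * (D z / z) =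
        cexp (z * t) * (cexp (z * h) - 1) * (D z / z) := by
      rw [mul_sub, ← Complex.exp_add]; push_cast; ring_nf
    have e2 : ‖cexp (z * t)‖ = Real.exp (a * t) := by
      rw [Complex.norm_exp]; simp [hre]
    have e3 : ‖cexp (z * h) - 1‖ ≤ (1 + Real.exp a) * (‖z‖ ^ s * h ^ s) := by
      have := norm_exp_sub_one_le_rpow (w := z * h) (R := a) (s := s) ha.le ?_ hs.le hs1.le
      · rwa [norm_mul, Complex.norm_real, Real.norm_of_nonneg hh.le,
          Real.mul_rpow (norm_nonneg _) hh.le] at this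
      · simp only [mul_re, ofReal_re, ofReal_im, mul_zero, sub_zero, hre]
        nlinarith
    have e4 : ‖D z‖ ≤ C * (1 + η ^ 2) ^ (-1 / 2 : ℝ) := by
      have := hbd z hre.ge (hre.le.trans hac); rwa [him] at this
    have e5 : ‖z‖ ^ s * ‖z‖⁻¹ ≤ A * (1 + η ^ 2) ^ (-(1 - s) / 2) := by
      have h1 : ‖z‖ ^ s * ‖z‖⁻¹ = (‖z‖⁻¹) ^ (1 - s) := by
        rw [Real.inv_rpow hzne.le, ← Real.rpow_neg hzne.le, ← Real.rpow_neg_one ‖z‖,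
          ← Real.rpow_add hzne]
        congr 1; ring
      rw [h1]
      have h2 := inv_norm_le_of_le_re ha hre.ge
      rw [him] at h2
      calc _ ≤ (A * (1 + η ^ 2) ^ (-1 / 2 : ℝ)) ^ (1 - s) :=
            Real.rpow_le_rpow (by positivity) h2 (by linarith)
        _ = A ^ (1 - s) * (1 + η ^ 2) ^ (-(1 - s) / 2) := by
            rw [Real.mul_rpow (by positivity) (by positivity), ← Real.rpow_mul (by positivity)]
            congr 2; ring
        _ ≤ _ := by
            gcongr
            simpa using Real.rpow_le_rpow_of_exponent_le hA1 (show 1 - s ≤ 1 by linarith)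
    rw [e1, norm_mul, norm_mul, e2, norm_div, div_eq_mul_inv]
    calc Real.exp (a * t) * ‖cexp (z * h) - 1‖ * (‖D z‖ * ‖z‖⁻¹)
        ≤ Real.exp (a * t) * ((1 + Real.exp a) * (‖z‖ ^ s * h ^ s)) *
          ((C * (1 + η ^ 2) ^ (-1 / 2 : ℝ)) * ‖z‖⁻¹) := by gcongr
      _ = Real.exp (a * t) * (1 + Real.exp a) * h ^ s * C * (1 + η ^ 2) ^ (-1 / 2 : ℝ) *
          (‖z‖ ^ s * ‖z‖⁻¹) := by ring
      _ ≤ Real.exp (a * t) * (1 + Real.exp a) * h ^ s * C * (1 + η ^ 2) ^ (-1 / 2 : ℝ) *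
          (A * (1 + η ^ 2) ^ (-(1 - s) / 2)) := by gcongr
      _ = ((1 + Real.exp a) * C * A * Real.exp (a * t) * h ^ s) *
          ((1 + η ^ 2) ^ (-1 / 2 : ℝ) * (1 + η ^ 2) ^ (-(1 - s) / 2)) := by ring
      _ = _ := by
          rw [← Real.rpow_add (by positivity)]
          congr 2; ring
  have hfinal := norm_integral_le_of_norm_le ((hint (2 - s) (by linarith)).const_mul _)
    (Eventually.of_forall hpt)
  rw [integral_const_mul] at hfinal
  have hn : ‖(2 * Real.pi : ℂ)⁻¹‖ = (2 * Real.pi)⁻¹ := by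
    rw [norm_inv]; simp [abs_of_pos Real.pi_pos]
  rw [hn]
  calc _ ≤ (2 * Real.pi)⁻¹ * _ := mul_le_mul_of_nonneg_left hfinal (by positivity)
    _ = _ := by ring

end Tauberian

end MarkovRenewal

namespace MarkovRenewal

/-! ### From increments to pointwise bounds by monotonicity -/

section Tauberian

open Complex in
/-- A monotone function whose antiderivative has small increments around that of a smooth function
`m` is close to `m`. -/
theorem monotone_isBigO_of_increment_bound {u : ℝ → ℝ} {m : ℝ → ℂ} {a θ B K : ℝ} (ha : 0 < a)
    (haθ : a < θ) (hK : 0 < K) (hu : MonotoneOn u (Set.Ici 0))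
    (hm : ∀ t : ℝ, DifferentiableAt ℝ m t)
    (hm' : ∀ t : ℝ, 0 ≤ t → ‖deriv m t‖ ≤ B * Real.exp (K * t))
    (hinc : ∀ s : ℝ, 0 < s → s < 1 → ∃ M : ℝ, ∀ t h : ℝ, 0 ≤ t → 0 < h → h ≤ 1 →
      ‖∫ x in t..(t + h), ((u x : ℂ) - m x)‖ ≤ M * Real.exp (a * t) * h ^ s) :
    (fun t => (u t : ℂ) - m t) =O[atTop] fun t => Real.exp (θ * t) := by
  have hB : 0 ≤ B := by
    have := (norm_nonneg _).trans (hm' 0 le_rfl); simpa using this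
  -- `α` stands for `1 - s`. Dividing the increment bound by `h = e^{-Kt}` costs `h^{-α} = e^{αKt}`,
  -- which must not exceed `e^{(θ - a)t}`.
  set α : ℝ := min (1 / 2) ((θ - a) / K) with hα
  have hα0 : 0 < α := by
    rw [hα]; exact lt_min (by norm_num) (div_pos (by linarith) hK)
  have hα1 : α < 1 := lt_of_le_of_lt (min_le_left _ _) (by norm_num)
  have hαK : α * K ≤ θ - a := by
    calc α * K ≤ ((θ - a) / K) * K := by gcongr; exact min_le_right _ _
      _ = θ - a := by field_simp
  obtain ⟨M', hM'⟩ := hinc (1 - α) (by linarith) (by linarith)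
  set M : ℝ := max M' 0 with hMdef
  have hM0 : 0 ≤ M := le_max_right _ _
  have hM : ∀ t h : ℝ, 0 ≤ t → 0 < h → h ≤ 1 →
      ‖∫ x in t..(t + h), ((u x : ℂ) - m x)‖ ≤ M * Real.exp (a * t) * h ^ (1 - α) := by
    intro t h h1 h2 h3
    refine (hM' t h h1 h2 h3).trans ?_
    gcongr
    exact le_max_left _ _
  have hmc : Continuous m := continuous_iff_continuousAt.mpr fun t => (hm t).continuousAt
  have huI : ∀ x y : ℝ, 0 ≤ x → x ≤ y → IntervalIntegrable u volume x y := fun x y hx hxy =>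
    MonotoneOn.intervalIntegrable (by
      rw [Set.uIcc_of_le hxy]; exact hu.mono fun z hz => hx.trans hz.1)
  have huIc : ∀ x y : ℝ, 0 ≤ x → x ≤ y → IntervalIntegrable (fun s => (u s : ℂ)) volume x y :=
    fun x y hx hxy => ⟨(huI x y hx hxy).1.ofReal, (huI x y hx hxy).2.ofReal⟩
  refine IsBigO.of_bound (2 * (M + B * Real.exp K)) ?_
  filter_upwards [eventually_ge_atTop 1] with t ht
  -- Near `t` the slope of `m` is at most `B e^{K(t+1)}`, so `m` varies by at most `B e^K` over
  -- length `h`. Since `h ≤ 1 ≤ t`, the left interval stays in `[0, ∞)`.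
  set h : ℝ := Real.exp (-(K * t)) with hh
  have hh0 : 0 < h := Real.exp_pos _
  have hh1 : h ≤ 1 := Real.exp_le_one_iff.mpr (by nlinarith)
  have hLip : ∀ x ∈ Set.Icc (t - 1) (t + 1), ‖m x - m t‖ ≤ B * Real.exp (K * (t + 1)) * |x - t| := by
    intro x hx
    have := Convex.norm_image_sub_le_of_norm_deriv_le (f := m) (𝕜 := ℝ)
      (s := Set.Icc (t - 1) (t + 1)) (C := B * Real.exp (K * (t + 1))) (x := t) (y := x)
      (fun y _ => hm y) (fun y hy => (hm' y (by linarith [hy.1])).trans ?_) (convex_Icc _ _)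
      ⟨by linarith, by linarith⟩ hx
    · simpa using this
    · gcongr; exact hy.2
  -- the two averages
  have key : ∀ x : ℝ, t - h ≤ x → x ≤ t →
      ‖∫ y in x..(x + h), ((u y : ℂ) - m t)‖ ≤
        h * ((M + B * Real.exp K) * Real.exp (θ * t)) := by
    intro x hx1 hx2
    have hx0 : 0 ≤ x := by linarith
    have hsplit : ∫ y in x..(x + h), ((u y : ℂ) - m t) =
        (∫ y in x..(x + h), ((u y : ℂ) - m y)) + ∫ y in x..(x + h), (m y - m t) := by
      rw [← intervalIntegral.integral_add]
      · simp
      · exact (huIc _ _ hx0 (by linarith)).sub (hmc.intervalIntegrable _ _)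
      · exact (hmc.sub continuous_const).intervalIntegrable _ _
    rw [hsplit]
    have h1 : ‖∫ y in x..(x + h), (m y - m t)‖ ≤ B * Real.exp (K * (t + 1)) * h * |x + h - x| := by
      apply intervalIntegral.norm_integral_le_of_norm_le_const
      intro y hy
      rw [Set.uIoc_of_le (by linarith)] at hy
      refine (hLip y ⟨by linarith [hy.1], by linarith [hy.2]⟩).trans ?_
      gcongr
      rw [abs_le]; constructor <;> linarith [hy.1, hy.2]
    rw [add_sub_cancel_left, abs_of_pos hh0] at h1
    have e1 : Real.exp (K * (t + 1)) * h = Real.exp K := by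
      rw [hh, ← Real.exp_add]; congr 1; ring
    have e2 : h ^ (1 - α) = h * Real.exp (α * K * t) := by
      rw [hh, ← Real.exp_mul, ← Real.exp_add]; congr 1; ring
    have e3 : Real.exp (a * x) * Real.exp (α * K * t) ≤ Real.exp (θ * t) := by
      rw [← Real.exp_add]; gcongr
      nlinarith
    have e4 : 1 ≤ Real.exp (θ * t) := Real.one_le_exp (by nlinarith)
    calc _ ≤ M * Real.exp (a * x) * h ^ (1 - α) + B * Real.exp (K * (t + 1)) * h * h :=
          (norm_add_le _ _).trans (add_le_add (hM x h hx0 hh0 hh1) h1)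
      _ = h * (M * (Real.exp (a * x) * Real.exp (α * K * t)) + B * Real.exp K * 1) := by
          rw [e2, mul_assoc B, e1]; ring
      _ ≤ h * (M * Real.exp (θ * t) + B * Real.exp K * Real.exp (θ * t)) := by gcongr
      _ = _ := by ring
  -- `u` is real, so the imaginary part sees only `m t` and is bounded at once; monotonicity is
  -- needed for the real part alone.
  have hre : ∀ x : ℝ, 0 ≤ x → (∫ y in x..(x + h), ((u y : ℂ) - m t)) =
      ((∫ y in x..(x + h), (u y - (m t).re) : ℝ) : ℂ) - (h * (m t).im : ℝ) * I := by
    intro x hx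
    have e : ∀ y : ℝ, (u y : ℂ) - m t = ((u y - (m t).re : ℝ) : ℂ) - (m t).im * I := by
      intro y
      apply Complex.ext <;> simp
    simp_rw [e]
    rw [intervalIntegral.integral_sub, intervalIntegral.integral_ofReal]
    · simp [mul_assoc]
      ring
    · exact ⟨((huI _ _ hx (by linarith)).sub intervalIntegrable_const).1.ofReal,
        ((huI _ _ hx (by linarith)).sub intervalIntegrable_const).2.ofReal⟩
    · exact intervalIntegrable_const
  set X : ℝ := (M + B * Real.exp K) * Real.exp (θ * t) with hX
  have hR : ∀ x : ℝ, t - h ≤ x → x ≤ t →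
      |∫ y in x..(x + h), (u y - (m t).re)| ≤ h * X ∧ h * |(m t).im| ≤ h * X := by
    intro x h1 h2
    have hk := key x h1 h2
    rw [hre x (by linarith)] at hk
    have hr := (abs_re_le_norm _).trans hk
    have hi := (abs_im_le_norm _).trans hk
    simp only [sub_re, ofReal_re, mul_re, I_re, mul_zero, ofReal_im, I_im, mul_one, sub_self,
      sub_zero] at hr
    simp only [sub_im, ofReal_im, mul_im, I_re, mul_zero, I_im, mul_one, ofReal_re, add_zero,
      zero_sub, abs_neg, abs_mul, abs_of_pos hh0] at hi
    exact ⟨hr, hi⟩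
  -- On `[t, t + h]` monotone `u` stays above `u t`, on `[t - h, t]` below it: the first average
  -- bounds `u t` from above, the second from below.
  have hup : h * (u t - (m t).re) ≤ h * X := by
    refine le_trans ?_ ((le_abs_self _).trans (hR t (by linarith) le_rfl).1)
    have : ∫ y in t..(t + h), (u t - (m t).re) ≤ ∫ y in t..(t + h), (u y - (m t).re) := by
      apply intervalIntegral.integral_mono_on (by linarith) intervalIntegrable_const
      · exact (huI _ _ (by linarith) (by linarith)).sub intervalIntegrable_const
      · intro y hy
        have := hu (show (0:ℝ) ≤ t by linarith) (show (0:ℝ) ≤ y by linarith [hy.1]) hy.1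
        linarith
    simpa only [intervalIntegral.integral_const, smul_eq_mul, add_sub_cancel_left] using this
  have hlo : -(h * X) ≤ h * (u t - (m t).re) := by
    refine le_trans (neg_le_of_abs_le (hR (t - h) le_rfl (by linarith)).1) ?_
    have : ∫ y in (t - h)..(t - h + h), (u y - (m t).re) ≤
        ∫ y in (t - h)..(t - h + h), (u t - (m t).re) := by
      apply intervalIntegral.integral_mono_on (by linarith)
      · exact (huI _ _ (by linarith) (by linarith)).sub intervalIntegrable_const
      · exact intervalIntegrable_const
      · intro y hy
        have := hu (show (0:ℝ) ≤ y by linarith [hy.1]) (show (0:ℝ) ≤ t by linarith)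
          (by linarith [hy.2])
        linarith
    simpa only [intervalIntegral.integral_const, smul_eq_mul, add_sub_cancel_left] using this
  have h1 : |u t - (m t).re| ≤ X := by
    rw [abs_le]
    constructor
    · exact le_of_mul_le_mul_left (by linarith) hh0
    · exact le_of_mul_le_mul_left hup hh0
  have h2 : |(m t).im| ≤ X := le_of_mul_le_mul_left (hR t (by linarith) le_rfl).2 hh0
  have h3 := Complex.norm_le_abs_re_add_abs_im ((u t : ℂ) - m t)
  simp only [sub_re, ofReal_re, sub_im, ofReal_im, zero_sub, abs_neg] at h3
  rw [Real.norm_of_nonneg (Real.exp_pos _).le]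
  linarith

-- Extension of the difference by zero to the negative axis turns the one-sided transform into the
-- two-sided one of `exists_increment_bound`. The restriction `a > 0` is removed in `tauberian` by
-- an exponential weight.
open Complex in
theorem tauberian_of_pos {u : ℝ → ℝ} {m : ℝ → ℂ} {D : ℂ → ℂ} {a c θ B C K : ℝ} (ha : 0 < a)
    (haθ : a < θ) (hac : a ≤ c) (hK : 0 < K) (hu : MonotoneOn u (Set.Ici 0))
    (hm : ∀ t : ℝ, DifferentiableAt ℝ m t)
    (hm' : ∀ t : ℝ, 0 ≤ t → ‖deriv m t‖ ≤ B * Real.exp (K * t))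
    (hw : IntegrableOn (fun t : ℝ => cexp (-(c : ℂ) * t) * (u t - m t)) (Set.Ioi 0))
    (hD : DifferentiableOn ℂ D {z | a ≤ z.re ∧ z.re ≤ c})
    (hbd : ∀ z : ℂ, a ≤ z.re → z.re ≤ c → ‖D z‖ ≤ C * (1 + z.im ^ 2) ^ (-1 / 2 : ℝ))
    (htr : ∀ η : ℝ, ∫ t in Set.Ioi (0 : ℝ), cexp (-(c + η * I) * t) * (u t - m t) =
      D (c + η * I)) :
    (fun t => (u t : ℂ) - m t) =O[atTop] fun t => Real.exp (θ * t) := by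
  set w : ℝ → ℂ := (Set.Ioi (0 : ℝ)).indicator fun t => u t - m t with hwdef
  have hind : ∀ z : ℂ, (fun t : ℝ => cexp (z * t) * w t) =
      (Set.Ioi (0 : ℝ)).indicator fun t => cexp (z * t) * (u t - m t) := by
    intro z
    funext t
    rw [hwdef]
    by_cases ht : t ∈ Set.Ioi (0 : ℝ)
    · rw [Set.indicator_of_mem ht, Set.indicator_of_mem ht]
    · rw [Set.indicator_of_notMem ht, Set.indicator_of_notMem ht, mul_zero]
  refine monotone_isBigO_of_increment_bound ha haθ hK hu hm hm' fun s hs hs1 => ?_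
  obtain ⟨M, hM⟩ := exists_increment_bound (w := w) ha hac hs hs1
    (by rw [hind]; exact (integrable_indicator_iff measurableSet_Ioi).mpr hw) hD hbd
    (fun η => by rw [hind, integral_indicator measurableSet_Ioi]; exact htr η)
  refine ⟨M, fun t h ht hh hh1 => ?_⟩
  have := hM t h hh hh1
  rwa [intervalIntegral.integral_congr_ae (g := fun x => (u x : ℂ) - m x)] at this
  refine Eventually.of_forall fun x hx => ?_
  rw [Set.uIoc_of_le (by linarith)] at hx
  rw [hwdef, Set.indicator_of_mem (Set.mem_Ioi.mpr (by linarith [hx.1]))]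

open Complex in
/-- **A Tauberian theorem with remainder.** Let `u` be monotone and nonnegative on `[0, ∞)`. If the
difference of the Laplace transforms of `u` and of a smooth function `m` continues analytically from
`Re z = c` to the strip `a ≤ Re z ≤ c`, with decay of order `|Im z|⁻¹`, then
`u t = m t + O(e^{θ t})` for every `θ > a`. -/
theorem tauberian {u : ℝ → ℝ} {m : ℝ → ℂ} {D : ℂ → ℂ} {a c θ B C K : ℝ}
    (haθ : a < θ) (hac : a ≤ c) (hu : MonotoneOn u (Set.Ici 0)) (hu0 : ∀ t, 0 ≤ u t)
    (hm : ∀ t : ℝ, DifferentiableAt ℝ m t)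
    (hmb : ∀ t : ℝ, 0 ≤ t → ‖m t‖ ≤ B * Real.exp (K * t))
    (hm' : ∀ t : ℝ, 0 ≤ t → ‖deriv m t‖ ≤ B * Real.exp (K * t))
    (hw : IntegrableOn (fun t : ℝ => cexp (-(c : ℂ) * t) * (u t - m t)) (Set.Ioi 0))
    (hD : DifferentiableOn ℂ D {z | a ≤ z.re ∧ z.re ≤ c})
    (hbd : ∀ z : ℂ, a ≤ z.re → z.re ≤ c → ‖D z‖ ≤ C * (1 + z.im ^ 2) ^ (-1 / 2 : ℝ))
    (htr : ∀ η : ℝ, ∫ t in Set.Ioi (0 : ℝ), cexp (-(c + η * I) * t) * (u t - m t) =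
      D (c + η * I)) :
    (fun t => (u t : ℂ) - m t) =O[atTop] fun t => Real.exp (θ * t) := by
  have hB : 0 ≤ B := by
    have := (norm_nonneg _).trans (hm' 0 le_rfl); simpa using this
  -- The weight `e^{βt}` moves the strip to the right, to `a + β ≥ 1`. As `β ≥ 0` and `u ≥ 0`, the
  -- function `e^{βt} u t` is still monotone.
  set β : ℝ := max (1 - a) 0 with hβ
  have hβ0 : 0 ≤ β := le_max_right _ _
  have hβa : 0 < a + β := by linarith [le_max_left (1 - a) 0]
  have hexp : ∀ (z : ℂ) (t : ℝ), cexp (-(z + β) * t) * ((Real.exp (β * t) * u t : ℝ) -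
      cexp (β * t) * m t) = cexp (-z * t) * (u t - m t) := by
    intro z t
    have : cexp (-(z + β) * t) * cexp (β * t) = cexp (-z * t) := by
      rw [← Complex.exp_add]; congr 1; ring
    rw [← this]; push_cast; ring
  have hexpn : ∀ t : ℝ, ‖cexp (β * t)‖ = Real.exp (β * t) := by
    intro t; rw [Complex.norm_exp]; simp
  have hde : ∀ t : ℝ, HasDerivAt (fun t : ℝ => cexp (β * t)) (cexp (β * t) * β) t := by
    intro t
    have := ((hasDerivAt_id (t : ℂ)).const_mul (β : ℂ)).cexp.comp_ofReal
    simpa using this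
  have hmain := tauberian_of_pos (u := fun t => Real.exp (β * t) * u t)
    (m := fun t => cexp (β * t) * m t) (D := fun z => D (z - β)) (a := a + β) (c := c + β)
    (θ := θ + β) (B := (β + 1) * B) (C := C) (K := max K 0 + β + 1) hβa (by linarith) (by linarith)
    (by have := le_max_right K 0; linarith)
    (fun x hx y hy hxy => mul_le_mul (by gcongr) (hu hx hy hxy) (hu0 x) (Real.exp_pos _).le)
    (fun t => (hde t).differentiableAt.mul (hm t)) ?_ ?_ ?_ ?_ ?_
  · have h2 := (isBigO_refl (fun t : ℝ => Real.exp (-(β * t))) atTop).smul hmain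
    refine (IsBigO.trans (IsBigO.of_bound 1 (Eventually.of_forall fun t => ?_)) h2).trans_eventuallyEq
      (Eventually.of_forall fun t => ?_)
    · have e : ((Real.exp (β * t) * u t : ℝ) : ℂ) - cexp (β * t) * m t =
          cexp (β * t) * (u t - m t) := by push_cast; ring
      have e2 : Real.exp (β * t) * Real.exp (-(β * t)) = 1 := by
        rw [← Real.exp_add]; simp
      rw [e, one_mul, norm_smul, norm_mul, hexpn, Real.norm_of_nonneg (Real.exp_pos _).le]
      nlinarith [norm_nonneg ((u t : ℂ) - m t)]
    · beta_reduce
      rw [smul_eq_mul, ← Real.exp_add]; congr 1; ring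
  · intro t ht
    rw [((hde t).fun_mul (hm t).hasDerivAt).deriv]
    have h1 := hmb t ht
    have h2 := hm' t ht
    have h3 : Real.exp (K * t) ≤ Real.exp ((max K 0 + 1) * t) := by
      gcongr; linarith [le_max_left K 0]
    calc _ ≤ Real.exp (β * t) * β * ‖m t‖ + Real.exp (β * t) * ‖deriv m t‖ := by
          refine (norm_add_le _ _).trans (le_of_eq ?_)
          rw [norm_mul, norm_mul, norm_mul, hexpn]
          simp [abs_of_nonneg hβ0]
      _ ≤ Real.exp (β * t) * β * (B * Real.exp ((max K 0 + 1) * t)) +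
          Real.exp (β * t) * (B * Real.exp ((max K 0 + 1) * t)) := by
          gcongr
          · exact h1.trans (by gcongr)
          · exact h2.trans (by gcongr)
      _ = (β + 1) * B * (Real.exp (β * t) * Real.exp ((max K 0 + 1) * t)) := by ring
      _ = _ := by rw [← Real.exp_add]; congr 2; ring
  · refine hw.congr_fun (fun t _ => ?_) measurableSet_Ioi
    have := hexp c t
    push_cast at this ⊢
    exact this.symm
  · refine hD.comp (by fun_prop) fun z hz => ?_
    simp only [Set.mem_ofPred_eq, sub_re, ofReal_re] at hz ⊢
    constructor <;> linarith [hz.1, hz.2]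
  · intro z h1 h2
    have := hbd (z - β) (by simp; linarith) (by simp; linarith)
    simpa using this
  · intro η
    have e : ((c + β : ℝ) : ℂ) + η * I - β = c + η * I := by push_cast; ring
    simp only [e]
    rw [← htr η]
    refine setIntegral_congr_fun measurableSet_Ioi fun t _ => ?_
    have := hexp (c + η * I) t
    push_cast at this ⊢
    rw [← this]; congr 2; ring

end Tauberian

end MarkovRenewal

namespace MarkovRenewal

/-! ### Lower bounds for holomorphic functions on strips -/

section LowerBound

open Complex Metric in
/-- A zero-free bounded holomorphic function on a disc is bounded below on smaller discs in terms
of its value at the centre. -/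
theorem lower_bound_of_ne_zero_on_ball {f : ℂ → ℂ} {c z : ℂ} {R r M δ : ℝ} (hδ : 0 < δ)
    (hrR : r < R) (hf : DifferentiableOn ℂ f (ball c R)) (hf0 : ∀ w ∈ ball c R, f w ≠ 0)
    (hM : ∀ w ∈ ball c R, ‖f w‖ ≤ M) (hc : δ ≤ ‖f c‖) (hz : dist z c ≤ r) :
    δ * Real.exp (-(2 * (Real.log (M / δ) + 1) * r / (R - r))) ≤ ‖f z‖ := by
  have hr : 0 ≤ r := dist_nonneg.trans hz
  have hR : 0 < R := hr.trans_lt hrR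
  have hcb : c ∈ ball c R := mem_ball_self hR
  have hzb : z ∈ ball c R := mem_ball.mpr (hz.trans_lt hrR)
  have hδM : δ ≤ M := hc.trans (hM c hcb)
  have hlog : 0 ≤ Real.log (M / δ) := Real.log_nonneg ((one_le_div hδ).mpr hδM)
  have hdf : ∀ w ∈ ball c R, DifferentiableAt ℂ f w := fun w hw =>
    hf.differentiableAt (isOpen_ball.mem_nhds hw)
  -- A primitive of `f'/f` vanishing at `c` is a logarithm of `f / f(c)`.
  obtain ⟨g, hgc, hg⟩ := (((hf.deriv isOpen_ball).div hf hf0).isExactOn_ball).with_val_at c 0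
  have hprod : ∀ w ∈ ball c R, HasDerivAt (fun w => f w * cexp (-g w)) 0 w := by
    intro w hw
    have h1 := (hdf w hw).hasDerivAt.mul ((hg w hw).neg.cexp)
    convert! h1 using 1
    have := hf0 w hw
    simp only [Pi.div_apply]
    field_simp
    ring
  have hfg : ∀ w ∈ ball c R, f w = f c * cexp (g w) := by
    intro w hw
    have := isOpen_ball.is_const_of_deriv_eq_zero (convex_ball c R).isPreconnected
      (fun w hw => (hprod w hw).differentiableAt.differentiableWithinAt)
      (fun w hw => (hprod w hw).deriv) hw hcb
    simp only [hgc, neg_zero, Complex.exp_zero, mul_one] at this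
    rw [← this, mul_assoc, ← Complex.exp_add]
    simp
  -- The summand `1` makes the bound strictly positive, as Borel-Carathéodory requires, even when `M
  -- = δ`.
  have hre : ∀ w ∈ ball c R, (g w).re ≤ Real.log (M / δ) + 1 := by
    intro w hw
    have h1 : ‖f c‖ * Real.exp (g w).re ≤ M := by
      have := hM w hw
      rwa [hfg w hw, norm_mul, Complex.norm_exp] at this
    have h2 : Real.exp (g w).re ≤ M / δ := by
      rw [le_div_iff₀ hδ, mul_comm]
      exact le_trans (by gcongr) h1
    have := Real.log_le_log (Real.exp_pos _) h2
    rw [Real.log_exp] at this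
    linarith
  have hbc := borelCaratheodory_zero (f := fun w => g (c + w)) (M := Real.log (M / δ) + 1) (R := R)
    (z := z - c) (by linarith) ?_ ?_ hR ?_ (by simpa using hgc)
  · rw [add_sub_cancel, ← dist_eq_norm] at hbc
    have h1 : ‖g z‖ ≤ 2 * (Real.log (M / δ) + 1) * r / (R - r) := by
      refine hbc.trans ?_
      gcongr
    rw [hfg z hzb, norm_mul, Complex.norm_exp]
    gcongr
    have := (neg_le_abs _).trans (abs_re_le_norm (g z))
    linarith
  · intro w hw
    have hw' : c + w ∈ ball c R := by simpa [dist_eq_norm] using hw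
    have := (hg _ hw').differentiableAt.comp w ((differentiableAt_id.const_add c) :
      DifferentiableAt ℂ (fun w => c + w) w)
    exact this.differentiableWithinAt
  · intro w hw
    exact hre _ (by simpa [dist_eq_norm] using hw)
  · simpa [dist_eq_norm] using hzb

open Complex Metric in
/-- A bounded holomorphic function on a half-plane which is bounded away from zero on two vertical
lines and has finitely many zeros to the right of the first one is bounded away from zero on the
strip between them, outside of a compact set. -/
theorem exists_strip_lower_bound {f : ℂ → ℂ} {θ₀ θ c M δ ρ : ℝ} (h0 : θ₀ < θ) (hθc : θ < c)
    (hδ : 0 < δ) (hρ : 0 < ρ)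
    (hf : DifferentiableOn ℂ f {z | θ₀ < z.re}) (hM : ∀ z : ℂ, θ₀ < z.re → ‖f z‖ ≤ M)
    (hfθ : ∀ η : ℝ, δ ≤ ‖f (θ + η * I)‖) (hfc : ∀ η : ℝ, δ ≤ ‖f (c + η * I)‖)
    (hfin : {z : ℂ | f z = 0 ∧ θ < z.re}.Finite) :
    ∃ r : ℝ, 0 < r ∧ r ≤ ρ ∧ θ₀ < θ - r ∧ (∀ z : ℂ, |z.re - θ| ≤ r → f z ≠ 0) ∧
      ∃ T δ' : ℝ, 0 < δ' ∧ ∀ z : ℂ, θ - r ≤ z.re → z.re ≤ c → T ≤ |z.im| → δ' ≤ ‖f z‖ := by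
  have hM0 : 0 < M := by
    refine lt_of_lt_of_le (lt_of_lt_of_le hδ (hfθ 0)) (hM _ (by simpa using h0))
  set R₁ : ℝ := θ - θ₀ with hR₁
  have hR₁0 : 0 < R₁ := by linarith
  set R : ℝ := c - θ with hR
  have hR0 : 0 < R := by linarith
  -- The Schwarz estimate on discs of radius `R₁` has slope `2M/R₁`, so at distance `δR₁/(4M)` from
  -- the line `f` has changed by at most `δ/2`.
  set r : ℝ := min (min (R₁ / 2) (δ * R₁ / (4 * M))) (min (R / 2) ρ) with hr
  have hr0 : 0 < r := by
    rw [hr]; refine lt_min (lt_min ?_ ?_) (lt_min ?_ hρ) <;> positivity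
  have hr1 : r ≤ R₁ / 2 := (min_le_left _ _).trans (min_le_left _ _)
  have hr2 : r ≤ δ * R₁ / (4 * M) := (min_le_left _ _).trans (min_le_right _ _)
  have hr3 : r ≤ R / 2 := (min_le_right _ _).trans (min_le_left _ _)
  have hr4 : r ≤ ρ := (min_le_right _ _).trans (min_le_right _ _)
  have hnear : ∀ z : ℂ, |z.re - θ| ≤ r → δ / 2 ≤ ‖f z‖ := by
    intro z hz
    set w : ℂ := θ + z.im * I with hw
    have hwre : w.re = θ := by simp [hw]
    have hdist : dist z w = |z.re - θ| := by
      rw [dist_eq_norm]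
      have : z - w = ((z.re - θ : ℝ) : ℂ) := by
        apply Complex.ext <;> simp [hw]
      rw [this, Complex.norm_real, Real.norm_eq_abs]
    have hsub : ∀ ζ ∈ ball w R₁, θ₀ < ζ.re := by
      intro ζ hζ
      have h1 := (abs_re_le_norm (ζ - w)).trans_lt (by simpa [dist_eq_norm] using hζ)
      rw [sub_re, hwre, abs_lt] at h1
      linarith [h1.1]
    have := dist_le_div_mul_dist_of_mapsTo_ball (f := f) (c := w) (R₁ := R₁) (R₂ := 2 * M) (z := z)
      (hf.mono hsub) ?_ ?_
    · rw [hdist, dist_eq_norm] at this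
      have h2 : 2 * M / R₁ * |z.re - θ| ≤ δ / 2 := by
        calc _ ≤ 2 * M / R₁ * (δ * R₁ / (4 * M)) := by gcongr; exact hz.trans hr2
          _ = δ / 2 := by field_simp; norm_num
      have h3 := hfθ z.im
      have h4 := norm_sub_norm_le (f w) (f z)
      rw [norm_sub_rev] at h4
      linarith
    · intro ζ hζ
      rw [mem_closedBall, dist_eq_norm]
      have h1 := hM ζ (hsub ζ hζ)
      have h2 := hM w (hsub w (mem_ball_self hR₁0))
      linarith [norm_sub_le (f ζ) (f w)]
    · rw [mem_ball, hdist]; linarith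
  refine ⟨r, hr0, hr4, by linarith, fun z hz h => ?_, ?_⟩
  · have := hnear z hz
    rw [h, norm_zero] at this
    linarith
  obtain ⟨T₀, hT₀⟩ := (hfin.image fun z => |z.im|).bddAbove
  -- A disc of radius `R = c - θ` centred on `Re z = c` reaches exactly to `Re z = θ`; points with
  -- `Re z ≥ θ + r` lie within `R - r` of the centre at their own height, so one constant serves all
  -- heights.
  set q : ℝ := Real.exp (-(2 * (Real.log (M / δ) + 1) * (R - r) / (R - (R - r)))) with hq
  -- `T₀` bounds the heights of the zeros; a disc of radius `R` centred at height `T₀ + R + 1` or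
  -- more misses them.
  refine ⟨T₀ + R + 1, min (δ / 2) (δ * q), lt_min (by positivity) (by positivity), ?_⟩
  intro z h1 h2 h3
  rcases le_total z.re (θ + r) with h4 | h4
  · exact (min_le_left _ _).trans (hnear z (by rw [abs_le]; constructor <;> linarith))
  · refine (min_le_right _ _).trans ?_
    set w : ℂ := c + z.im * I with hw
    have hwre : w.re = c := by simp [hw]
    have hwim : w.im = z.im := by simp [hw]
    have hdist : dist z w ≤ R - r := by
      rw [dist_eq_norm]
      have : z - w = ((z.re - c : ℝ) : ℂ) := by
        apply Complex.ext <;> simp [hw]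
      rw [this, Complex.norm_real, Real.norm_eq_abs, abs_of_nonpos (by linarith)]
      linarith
    have hsub : ∀ ζ ∈ ball w R, θ < ζ.re ∧ T₀ < |ζ.im| := by
      intro ζ hζ
      have h5 : ‖ζ - w‖ < R := by simpa [dist_eq_norm] using hζ
      have h6 := (abs_re_le_norm (ζ - w)).trans_lt h5
      have h7 := (abs_im_le_norm (ζ - w)).trans_lt h5
      rw [sub_re, hwre, abs_lt] at h6
      rw [sub_im, hwim] at h7
      have h8 := abs_sub_abs_le_abs_sub z.im ζ.im
      rw [abs_sub_comm] at h8
      constructor <;> linarith [h6.1]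
    refine lower_bound_of_ne_zero_on_ball (R := R) (c := w) hδ (by linarith) (hf.mono ?_) ?_ ?_
      (hfc _) hdist
    · exact fun ζ hζ => h0.trans (hsub ζ hζ).1
    · intro ζ hζ hzero
      have := hT₀ (Set.mem_image_of_mem (fun z : ℂ => |z.im|) ⟨hzero, (hsub ζ hζ).1⟩)
      exact absurd (hsub ζ hζ).2 (not_lt.mpr this)
    · exact fun ζ hζ => hM ζ (h0.trans (hsub ζ hζ).1)

end LowerBound

end MarkovRenewal

namespace MarkovRenewal

/-! ### The renewal measure and its transform -/

section Renewal

variable {p : ℕ}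

theorem integrable_exp_iff {ν : Measure ℝ≥0} {z : ℂ} :
    Integrable (fun x : ℝ≥0 => Complex.exp (-z * ((x : ℝ) : ℂ))) ν ↔
      ∫⁻ x : ℝ≥0, ENNReal.ofReal (Real.exp (-z.re * (x : ℝ))) ∂ν < ∞ := by
  have hm : AEStronglyMeasurable (fun x : ℝ≥0 => Complex.exp (-z * ((x : ℝ) : ℂ))) ν :=
    Continuous.aestronglyMeasurable (by fun_prop)
  rw [Integrable, and_iff_right hm, hasFiniteIntegral_iff_norm]
  simp [Complex.norm_exp]

theorem mem_laplaceDomain_iff {μ : MeasureMatrix p} {z : ℂ} : z ∈ laplaceDomain μ ↔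
    ∀ i j, Integrable (fun x : ℝ≥0 => Complex.exp (-z * ((x : ℝ) : ℂ))) (μ i j) := by
  simp_rw [integrable_exp_iff]; rfl

theorem laplaceDomain_mono {μ : MeasureMatrix p} {z w : ℂ} (hz : z ∈ laplaceDomain μ)
    (h : z.re ≤ w.re) : w ∈ laplaceDomain μ := by
  intro i j
  refine lt_of_le_of_lt (lintegral_mono fun x => ?_) (hz i j)
  gcongr

instance sFinite_convPow {μ : MeasureMatrix p} [∀ i j, SFinite (μ i j)] (n : ℕ) (i j : Fin p) :
    SFinite (convPow μ n i j) := by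
  induction n generalizing i j with
  | zero => simp only [convPow]; split_ifs <;> infer_instance
  | succ n ih =>
    rw [convPow, conv, ← Measure.sum_fintype]
    infer_instance

instance sFinite_renewalMeasure {μ : MeasureMatrix p} [∀ i j, SFinite (μ i j)] (i j : Fin p) :
    SFinite (renewalMeasure μ i j) := by
  rw [renewalMeasure]; infer_instance

theorem lintegral_exp_conv {ν₁ ν₂ : Measure ℝ≥0} [SFinite ν₁] [SFinite ν₂] (s : ℝ) :
    ∫⁻ x : ℝ≥0, ENNReal.ofReal (Real.exp (s * (x : ℝ))) ∂(Measure.conv ν₁ ν₂) =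
      (∫⁻ x : ℝ≥0, ENNReal.ofReal (Real.exp (s * (x : ℝ))) ∂ν₁) *
        ∫⁻ x : ℝ≥0, ENNReal.ofReal (Real.exp (s * (x : ℝ))) ∂ν₂ := by
  rw [Measure.lintegral_conv (by fun_prop)]
  simp_rw [NNReal.coe_add, mul_add, Real.exp_add, ENNReal.ofReal_mul (Real.exp_pos _).le]
  rw [← lintegral_mul_const _ (by fun_prop)]
  congr 1
  funext x
  rw [lintegral_const_mul _ (by fun_prop)]

theorem integral_exp_conv {ν₁ ν₂ : Measure ℝ≥0} [SFinite ν₁] [SFinite ν₂] {z : ℂ}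
    (h : Integrable (fun x : ℝ≥0 => Complex.exp (-z * ((x : ℝ) : ℂ))) (Measure.conv ν₁ ν₂)) :
    ∫ x : ℝ≥0, Complex.exp (-z * ((x : ℝ) : ℂ)) ∂(Measure.conv ν₁ ν₂) =
      (∫ x : ℝ≥0, Complex.exp (-z * ((x : ℝ) : ℂ)) ∂ν₁) *
        ∫ x : ℝ≥0, Complex.exp (-z * ((x : ℝ) : ℂ)) ∂ν₂ := by
  rw [integral_conv h]
  simp_rw [NNReal.coe_add, Complex.ofReal_add, mul_add, Complex.exp_add, integral_const_mul,
    integral_mul_const]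

theorem mem_laplaceDomain_conv {μ ν : MeasureMatrix p} [∀ i j, SFinite (μ i j)]
    [∀ i j, SFinite (ν i j)] {z : ℂ} (hμ : z ∈ laplaceDomain μ) (hν : z ∈ laplaceDomain ν) :
    z ∈ laplaceDomain (conv μ ν) := by
  intro i j
  rw [conv, lintegral_finsetSum_measure]
  refine ENNReal.sum_lt_top.mpr fun k _ => ?_
  rw [lintegral_exp_conv]
  exact ENNReal.mul_lt_top (hμ i k) (hν k j)

theorem laplace_conv {μ ν : MeasureMatrix p} [∀ i j, SFinite (μ i j)]
    [∀ i j, SFinite (ν i j)] {z : ℂ} (hμ : z ∈ laplaceDomain μ) (hν : z ∈ laplaceDomain ν) :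
    laplace (conv μ ν) z = laplace μ z * laplace ν z := by
  have hi : ∀ i k j, Integrable (fun x : ℝ≥0 => Complex.exp (-z * ((x : ℝ) : ℂ)))
      (Measure.conv (μ i k) (ν k j)) := by
    intro i k j
    rw [integrable_exp_iff, lintegral_exp_conv]
    exact ENNReal.mul_lt_top (hμ i k) (hν k j)
  ext i j
  rw [Matrix.mul_apply, laplace, Matrix.of_apply, conv,
    integral_finsetSum_measure fun k _ => hi i k j]
  exact Finset.sum_congr rfl fun k _ => integral_exp_conv (hi i k j)

theorem mem_laplaceDomain_convPow {μ : MeasureMatrix p} [∀ i j, SFinite (μ i j)] {z : ℂ}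
    (hμ : z ∈ laplaceDomain μ) (n : ℕ) : z ∈ laplaceDomain (convPow μ n) := by
  induction n with
  | zero =>
    intro i j
    simp only [convPow]
    split_ifs
    · rw [lintegral_dirac]; simp
    · simp
  | succ n ih => exact mem_laplaceDomain_conv hμ ih

theorem laplace_convPow {μ : MeasureMatrix p} [∀ i j, SFinite (μ i j)] {z : ℂ}
    (hμ : z ∈ laplaceDomain μ) (n : ℕ) : laplace (convPow μ n) z = laplace μ z ^ n := by
  induction n with
  | zero =>
    ext i j
    simp only [laplace, Matrix.of_apply, convPow, pow_zero, Matrix.one_apply]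
    split_ifs
    · rw [integral_dirac]; simp
    · simp
  | succ n ih => rw [convPow, laplace_conv hμ (mem_laplaceDomain_convPow hμ n), ih, pow_succ']

open scoped Matrix.Norms.Operator in
theorem norm_entry_le {A : Matrix (Fin p) (Fin p) ℂ} (i j : Fin p) : ‖A i j‖ ≤ ‖A‖ := by
  rw [Matrix.linfty_opNorm_def, ← coe_nnnorm, NNReal.coe_le_coe]
  exact (Finset.single_le_sum (f := fun j => ‖A i j‖₊) (fun _ _ => zero_le) (Finset.mem_univ j)).trans
    (Finset.le_sup (f := fun i => ∑ j, ‖A i j‖₊) (Finset.mem_univ i))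

theorem lintegral_exp_eq_norm {ν : Measure ℝ≥0} {s : ℝ}
    (h : ∫⁻ x : ℝ≥0, ENNReal.ofReal (Real.exp (-s * (x : ℝ))) ∂ν < ∞) :
    ∫⁻ x : ℝ≥0, ENNReal.ofReal (Real.exp (-s * (x : ℝ))) ∂ν =
      ENNReal.ofReal ‖∫ x : ℝ≥0, Complex.exp (-(s : ℂ) * ((x : ℝ) : ℂ)) ∂ν‖ := by
  have e : ∀ x : ℝ≥0, Complex.exp (-(s : ℂ) * ((x : ℝ) : ℂ)) = (Real.exp (-s * (x : ℝ)) : ℝ) := by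
    intro x; push_cast; rfl
  have hi : Integrable (fun x : ℝ≥0 => Real.exp (-s * (x : ℝ))) ν := by
    refine ⟨Continuous.aestronglyMeasurable (by fun_prop), ?_⟩
    rw [hasFiniteIntegral_iff_norm]
    simpa using h
  simp_rw [e]
  rw [integral_complex_ofReal, Complex.norm_real, Real.norm_of_nonneg
    (integral_nonneg fun x => (Real.exp_pos _).le),
    ofReal_integral_eq_lintegral_ofReal hi (Eventually.of_forall fun x => (Real.exp_pos _).le)]

-- Dominated convergence: `e^{-sx}` tends to the indicator of `{0}`.
open scoped Matrix.Norms.Operator in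
theorem tendsto_laplace_atTop {μ : MeasureMatrix p} {θ : ℝ} (hθ : (θ : ℂ) ∈ laplaceDomain μ) :
    Tendsto (fun s : ℝ => laplace μ s) atTop (𝓝 (massAtZero μ)) := by
  refine tendsto_pi_nhds.mpr fun i => tendsto_pi_nhds.mpr fun j => ?_
  have hi := (mem_laplaceDomain_iff.mp hθ i j).norm
  have h0 : massAtZero μ i j = ∫ x : ℝ≥0, ({0} : Set ℝ≥0).indicator (fun _ => (1 : ℂ)) x ∂(μ i j) := by
    rw [integral_indicator (measurableSet_singleton 0)]
    simp [massAtZero, Measure.real]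
  rw [h0]
  refine tendsto_integral_filter_of_dominated_convergence _ ?_ ?_ hi ?_
  · exact Eventually.of_forall fun s => Continuous.aestronglyMeasurable (by fun_prop)
  · filter_upwards [eventually_ge_atTop θ] with s hs
    refine Eventually.of_forall fun x => ?_
    rw [Complex.norm_exp, Complex.norm_exp]
    simp only [Complex.mul_re, Complex.neg_re, Complex.ofReal_re, Complex.ofReal_im, mul_zero,
      sub_zero]
    gcongr
  · refine Eventually.of_forall fun x => ?_
    rcases eq_or_ne x 0 with rfl | hx
    · simp
    · rw [Set.indicator_of_notMem (by simpa using hx), tendsto_zero_iff_norm_tendsto_zero]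
      have h1 : Tendsto (fun s : ℝ => -s * (x : ℝ)) atTop atBot :=
        tendsto_neg_atTop_atBot.atBot_mul_const (by positivity)
      refine (Real.tendsto_exp_atBot.comp h1).congr fun s => ?_
      rw [Complex.norm_exp]
      simp

-- Gelfand's formula. Smallness of the norm of one fixed power is an open condition, so it passes
-- from `μ({0})` to `ℒμ(s)` for large `s`.
open scoped Matrix.Norms.Operator in
theorem exists_norm_pow_lt_one {A : Matrix (Fin p) (Fin p) ℂ} (hA : spectralRadius ℂ A < 1) :
    ∃ n : ℕ, n ≠ 0 ∧ ‖A ^ n‖ < 1 := by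
  have h := spectrum.pow_nnnorm_pow_one_div_tendsto_nhds_spectralRadius A
  obtain ⟨n, hn1, hn2⟩ := ((h.eventually (gt_mem_nhds hA)).and (eventually_ge_atTop 1)).exists
  refine ⟨n, by omega, ?_⟩
  by_contra! hge
  have h1 : (1 : ℝ≥0∞) ≤ (‖A ^ n‖₊ : ℝ≥0∞) := by
    rw [← ENNReal.coe_one, ENNReal.coe_le_coe]; exact_mod_cast hge
  exact absurd hn1 (not_lt.mpr (ENNReal.one_le_rpow h1 (by positivity)))

/-- Write `k = nq + r` with `r < n` and compare with a geometric series in `q`. -/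
theorem summable_norm_pow {R : Type*} [NormedRing R] {x : R} {n : ℕ} (hn : n ≠ 0)
    (hx : ‖x ^ n‖ < 1) : Summable fun k => ‖x ^ k‖ := by
  have : NeZero n := ⟨hn⟩
  rw [← (Nat.divModEquiv n).symm.summable_iff]
  have h1 : Summable fun q : ℕ => ‖(x ^ n) ^ q‖ := summable_norm_geometric_of_norm_lt_one hx
  have h2 : Summable fun r : Fin n => ‖x ^ (r : ℕ)‖ := (hasSum_fintype _).summable
  refine (h1.mul_of_nonneg h2 (fun _ => norm_nonneg _) (fun _ => norm_nonneg _)).of_nonneg_of_le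
    (fun _ => norm_nonneg _) fun q => ?_
  have : (Nat.divModEquiv n).symm q = n * q.1 + q.2 := by
    simp [Nat.divModEquiv, mul_comm]
  rw [Function.comp_apply, this, pow_add, pow_mul]
  exact norm_mul_le _ _

open scoped Matrix.Norms.Operator in
/-- If the spectral radius of `μ({0})` is less than one, the Laplace transform of the renewal
measure is finite far to the right. -/
theorem exists_mem_laplaceDomain_renewalMeasure {μ : MeasureMatrix p} [∀ i j, SFinite (μ i j)]
    {θ : ℝ} (hθ : (θ : ℂ) ∈ laplaceDomain μ) (hsp : spectralRadius ℂ (massAtZero μ) < 1) :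
    ∃ s : ℝ, 0 ≤ s ∧ θ ≤ s ∧ (s : ℂ) ∈ laplaceDomain (renewalMeasure μ) := by
  obtain ⟨n, hn, hlt⟩ := exists_norm_pow_lt_one hsp
  have hev : ∀ᶠ s : ℝ in atTop, ‖laplace μ s ^ n‖ < 1 :=
    ((tendsto_laplace_atTop hθ).pow n).norm.eventually (gt_mem_nhds hlt)
  obtain ⟨s, hs, hs0, hsθ⟩ :=
    (hev.and ((eventually_ge_atTop 0).and (eventually_ge_atTop θ))).exists
  refine ⟨s, hs0, hsθ, fun i j => ?_⟩
  have hsd : (s : ℂ) ∈ laplaceDomain μ := laplaceDomain_mono hθ (by simpa using hsθ)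
  have hsum := summable_norm_pow hn hs
  rw [renewalMeasure, lintegral_sum_measure]
  have h1 : ∀ k, ∫⁻ x : ℝ≥0, ENNReal.ofReal (Real.exp (-(s : ℂ).re * (x : ℝ))) ∂(convPow μ k i j) ≤
      ENNReal.ofReal ‖laplace μ s ^ k‖ := by
    intro k
    have h2 := mem_laplaceDomain_convPow hsd k i j
    rw [Complex.ofReal_re] at h2 ⊢
    rw [lintegral_exp_eq_norm h2, ← laplace_convPow hsd k]
    exact ENNReal.ofReal_le_ofReal (norm_entry_le (A := laplace (convPow μ k) s) i j)
  refine lt_of_le_of_lt (ENNReal.tsum_le_tsum h1) ?_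
  rw [← ENNReal.ofReal_tsum_of_nonneg (fun _ => norm_nonneg _) hsum]
  exact ENNReal.ofReal_lt_top

/-- The Laplace transform of the renewal measure inverts `1 - ℒμ`. -/
theorem one_sub_laplace_mul_laplace_renewalMeasure {μ : MeasureMatrix p} [∀ i j, SFinite (μ i j)]
    {z : ℂ} (hμ : z ∈ laplaceDomain μ) (hz : z ∈ laplaceDomain (renewalMeasure μ)) :
    (1 - laplace μ z) * laplace (renewalMeasure μ) z = 1 := by
  have hs : ∀ i j, HasSum (fun n => (laplace μ z ^ n) i j) (laplace (renewalMeasure μ) z i j) := by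
    intro i j
    have := hasSum_integral_measure (mem_laplaceDomain_iff.mp hz i j)
    refine this.congr_fun fun n => ?_
    rw [← laplace_convPow hμ]; rfl
  ext i j
  -- Multiplying the Neumann series by `ℒμ(z)` removes its first term, the identity.
  have h1 : HasSum (fun n => (laplace μ z ^ (n + 1)) i j)
      ((laplace μ z * laplace (renewalMeasure μ) z) i j) := by
    simp_rw [pow_succ', Matrix.mul_apply]
    exact hasSum_sum fun k _ => (hs k j).mul_left _
  have h2 := (hasSum_nat_add_iff' (f := fun n => (laplace μ z ^ n) i j) 1).mpr (hs i j)
  have h3 := h1.unique h2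
  rw [sub_mul, one_mul, Matrix.sub_apply, h3]
  simp

/-- Markov's inequality, as `e^{-sx} ≥ e^{-st}` on `[0, t]`. -/
theorem renewalFunction_lt_top {μ : MeasureMatrix p} {s : ℝ} (hs : 0 ≤ s)
    (h : (s : ℂ) ∈ laplaceDomain (renewalMeasure μ)) (t : ℝ) (i j : Fin p) :
    renewalFunction μ t i j < ∞ := by
  have h1 : {x : ℝ≥0 | (x : ℝ) ≤ t} ⊆ {x : ℝ≥0 | ENNReal.ofReal (Real.exp (-s * t)) ≤
      ENNReal.ofReal (Real.exp (-s * (x : ℝ)))} := by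
    intro x hx
    apply ENNReal.ofReal_le_ofReal
    rw [Real.exp_le_exp]
    have : (x : ℝ) ≤ t := hx
    nlinarith
  refine lt_of_le_of_lt (measure_mono h1) ?_
  refine lt_of_le_of_lt (meas_ge_le_lintegral_div (by fun_prop) ?_ ENNReal.ofReal_ne_top) ?_
  · simp [Real.exp_pos]
  · refine ENNReal.div_lt_top ?_ (by simp [Real.exp_pos])
    simpa using (h i j).ne

theorem monotone_renewalFunction {μ : MeasureMatrix p}
    (h : ∀ (t : ℝ) (i j : Fin p), renewalFunction μ t i j < ∞) (i j : Fin p) :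
    Monotone fun t => (renewalFunction μ t i j).toReal := fun _ t' htt' =>
  ENNReal.toReal_mono (h t' i j).ne (measure_mono fun _ hx => le_trans hx htt')

open Complex in
/-- The Laplace transform of the renewal function. -/
theorem laplace_renewalFunction {μ : MeasureMatrix p} [∀ i j, SFinite (μ i j)] {z : ℂ}
    (hz0 : 0 < z.re) (hz : z ∈ laplaceDomain (renewalMeasure μ)) (i j : Fin p) :
    IntegrableOn (fun t : ℝ => cexp (-z * t) * ((renewalFunction μ t i j).toReal : ℝ))
      (Set.Ioi 0) ∧
    ∫ t in Set.Ioi (0 : ℝ), cexp (-z * t) * ((renewalFunction μ t i j).toReal : ℝ) =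
      laplace (renewalMeasure μ) z i j / z := by
  set ν : Measure ℝ := (renewalMeasure μ i j).map (fun x : ℝ≥0 => (x : ℝ)) with hν
  have hm : Measurable (fun x : ℝ≥0 => (x : ℝ)) := measurable_coe_nnreal_real
  have hcum := laplace_cumulative (ν := ν) (f := fun _ => 1) hz0 (by
    rw [hν, integrable_map_measure (Continuous.aestronglyMeasurable (by fun_prop)) hm.aemeasurable]
    simpa [Function.comp_def] using mem_laplaceDomain_iff.mp hz i j)
  have hU : ∀ t : ℝ, ∫ x in Set.Iic t, (1 : ℂ) ∂ν = ((renewalFunction μ t i j).toReal : ℝ) := by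
    intro t
    rw [setIntegral_const, Measure.real, hν, Measure.map_apply hm measurableSet_Iic]
    simp [renewalFunction, Set.preimage, Set.Iic]
  have hneg : ∀ t : ℝ, t < 0 → (renewalFunction μ t i j) = 0 := by
    intro t ht
    rw [renewalFunction]
    convert! measure_empty (μ := renewalMeasure μ i j)
    ext x
    simp only [Set.mem_ofPred_eq, Set.mem_empty_iff_false, iff_false, not_le]
    exact ht.trans_le x.2
  simp_rw [hU] at hcum
  refine ⟨hcum.1.integrableOn, ?_⟩
  rw [← integral_Ici_eq_integral_Ioi, setIntegral_eq_integral_of_forall_compl_eq_zero, hcum.2, hν,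
    integral_map hm.aemeasurable (Continuous.aestronglyMeasurable (by fun_prop))]
  · simp [laplace]
  · intro t ht
    rw [hneg t (by simpa using ht)]
    simp

end Renewal

end MarkovRenewal

namespace MarkovRenewal

/-! ### Laurent expansions of the resolvent -/

section Laurent

variable {p : ℕ}

theorem analyticAt_dslope {g : ℂ → ℂ} {l : ℂ} (hg : AnalyticAt ℂ g l) :
    AnalyticAt ℂ (dslope g l) l := by
  obtain ⟨q, hq⟩ := hg
  exact ⟨_, hq.has_fpower_series_dslope_fslope⟩

/-- Iterated division by `w - l` through `dslope`; the identity holds for all `w`, not only near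
`l`. -/
theorem exists_taylor_remainder {g : ℂ → ℂ} {l : ℂ} (hg : AnalyticAt ℂ g l) (n : ℕ) :
    ∃ (a : ℕ → ℂ) (h : ℂ → ℂ), AnalyticAt ℂ h l ∧
      ∀ w, g w = ∑ j ∈ Finset.range n, a j * (w - l) ^ j + (w - l) ^ n * h w := by
  induction n with
  | zero => exact ⟨0, g, hg, by simp⟩
  | succ n ih =>
    obtain ⟨a, h, hh, hgw⟩ := ih
    refine ⟨fun j => if j = n then h l else a j, dslope h l, analyticAt_dslope hh, fun w => ?_⟩
    have h1 := sub_smul_dslope h l w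
    rw [smul_eq_mul] at h1
    rw [Finset.sum_range_succ]
    beta_reduce
    rw [if_pos rfl, hgw w]
    have h2 : ∑ j ∈ Finset.range n, (if j = n then h l else a j) * (w - l) ^ j =
        ∑ j ∈ Finset.range n, a j * (w - l) ^ j :=
      Finset.sum_congr rfl fun j hj => by rw [if_neg (Finset.mem_range.mp hj).ne]
    rw [h2, pow_succ, mul_assoc _ (w - l), h1]
    ring

/-- Taylor expansion of `G` to order `m`, divided by `(w - l)^m`: the coefficient of degree `j`
becomes that of `(w - l)^{-(m - j)}`, the remainder becomes `H`. -/
theorem exists_isLaurentExpansion {F G : ℂ → Matrix (Fin p) (Fin p) ℂ} {l : ℂ} {m : ℕ}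
    (hG : ∀ i j, AnalyticAt ℂ (fun w => G w i j) l)
    (hFG : ∀ᶠ w in 𝓝[≠] l, (w - l) ^ m • F w = G w) :
    ∃ A, IsLaurentExpansion F l m A := by
  choose a h hh hgw using fun i j => exists_taylor_remainder (hG i j) m
  refine ⟨fun k => if k = 0 then Matrix.of fun i j => h i j l else Matrix.of fun i j => a i j (m - k),
    fun w => Matrix.of fun i j => h i j w, hh, by simp, ?_⟩
  filter_upwards [hFG, self_mem_nhdsWithin] with w hw hwl
  have hx : w - l ≠ 0 := sub_ne_zero.mpr hwl
  have hF : F w = ((w - l) ^ m)⁻¹ • G w := by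
    rw [← hw, smul_smul, inv_mul_cancel₀ (pow_ne_zero m hx), one_smul]
  ext i j
  rw [hF, Matrix.smul_apply, hgw i j w, smul_eq_mul, mul_add, inv_mul_cancel_left₀ (pow_ne_zero m hx),
    Matrix.add_apply, Matrix.sum_apply, Finset.mul_sum, Matrix.of_apply]
  congr 1
  refine Finset.sum_nbij' (fun j => m - j) (fun k => m - k) ?_ ?_ ?_ ?_ ?_
  · intro k hk; simp at hk ⊢; omega
  · intro k hk; simp at hk ⊢; omega
  · intro k hk; simp at hk ⊢; omega
  · intro k hk; simp at hk ⊢; omega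
  · intro k hk
    have hk' : k < m := Finset.mem_range.mp hk
    have e : m = (m - k) + k := by omega
    rw [if_neg (by omega), Matrix.smul_apply, Matrix.of_apply, Nat.sub_sub_self hk'.le, smul_eq_mul]
    nth_rewrite 1 [e]
    rw [pow_add]
    field_simp

theorem analyticAt_det {M : ℂ → Matrix (Fin p) (Fin p) ℂ} {l : ℂ}
    (hM : ∀ i j, AnalyticAt ℂ (fun w => M w i j) l) : AnalyticAt ℂ (fun w => (M w).det) l := by
  simp_rw [Matrix.det_apply']
  refine Finset.analyticAt_fun_sum _ fun σ _ => analyticAt_const.mul ?_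
  exact Finset.analyticAt_fun_prod _ fun i _ => hM _ _

theorem analyticAt_adjugate {M : ℂ → Matrix (Fin p) (Fin p) ℂ} {l : ℂ}
    (hM : ∀ i j, AnalyticAt ℂ (fun w => M w i j) l) (i j : Fin p) :
    AnalyticAt ℂ (fun w => (M w).adjugate i j) l := by
  simp_rw [Matrix.adjugate_apply]
  refine analyticAt_det fun i' j' => ?_
  simp_rw [Matrix.updateRow_apply]
  split_ifs
  · exact analyticAt_const
  · exact hM _ _

theorem analyticAt_one_sub_laplace {μ : MeasureMatrix p} {l : ℂ}
    (hL : ∀ i j, AnalyticAt ℂ (fun w => laplace μ w i j) l) (i j : Fin p) :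
    AnalyticAt ℂ (fun w => (1 - laplace μ w) i j) l := by
  simp_rw [Matrix.sub_apply]
  exact analyticAt_const.sub (hL i j)

/-- Cramer's rule, valid also at singular points, where both sides are zero by convention. -/
theorem laplaceResolvent_eq (μ : MeasureMatrix p) (w : ℂ) :
    laplaceResolvent μ w = (1 - laplace μ w).det⁻¹ • (1 - laplace μ w).adjugate := by
  rw [laplaceResolvent, Matrix.inv_def, Ring.inverse_eq_inv']

theorem analyticAt_laplaceResolvent {μ : MeasureMatrix p} {l : ℂ}
    (hL : ∀ i j, AnalyticAt ℂ (fun w => laplace μ w i j) l)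
    (hdet : (1 - laplace μ l).det ≠ 0) (i j : Fin p) :
    AnalyticAt ℂ (fun w => laplaceResolvent μ w i j) l := by
  simp_rw [laplaceResolvent_eq, Matrix.smul_apply, smul_eq_mul]
  have h := analyticAt_one_sub_laplace hL
  exact ((analyticAt_det h).inv hdet).mul (analyticAt_adjugate h i j)

/-- The Laurent expansion of `(1 - ℒμ)⁻¹` up to the pole order. -/
theorem exists_isLaurentExpansion_laplaceResolvent {μ : MeasureMatrix p} {l : ℂ}
    (hl : l ∈ laplaceDomain μ) (hL : ∀ i j, AnalyticAt ℂ (fun w => laplace μ w i j) l)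
    (hdet : ∀ᶠ w in 𝓝[≠] l, (1 - laplace μ w).det ≠ 0) :
    ∃ A, IsLaurentExpansion (laplaceResolvent μ) l (poleOrder μ l) A := by
  have h := analyticAt_one_sub_laplace hL
  by_cases hroot : l ∈ roots μ
  · have hne : ¬∀ᶠ w in 𝓝 l, (1 - laplace μ w).det = 0 := fun h0 => by
      obtain ⟨w, hw1, hw2⟩ := (hdet.and (h0.filter_mono nhdsWithin_le_nhds)).exists
      exact hw1 hw2
    obtain ⟨n, g, hg, hg0, hfg⟩ := (analyticAt_det h).exists_eventuallyEq_pow_smul_nonzero_iff.mpr hne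
    -- The determinant has a zero of finite order `n`, so multiplying by `(w - l)^n` clears the
    -- pole. Without a member the infimum would be the default value `0`, which need not be
    -- attained.
    have hmem : ∃ n, n ∈ {n : ℕ | ∃ G : ℂ → Matrix (Fin p) (Fin p) ℂ,
        (∀ i j, AnalyticAt ℂ (fun w => G w i j) l) ∧
        ∀ᶠ w in 𝓝[≠] l, (w - l) ^ n • laplaceResolvent μ w = G w} := by
      refine ⟨n, fun w => (g w)⁻¹ • (1 - laplace μ w).adjugate, fun i j => ?_, ?_⟩
      · simp_rw [Matrix.smul_apply, smul_eq_mul]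
        exact (hg.inv hg0).mul (analyticAt_adjugate h i j)
      · filter_upwards [hfg.filter_mono nhdsWithin_le_nhds, self_mem_nhdsWithin] with w hw hwl
        have hx : (w - l) ^ n ≠ 0 := pow_ne_zero n (sub_ne_zero.mpr hwl)
        rw [laplaceResolvent_eq, hw, smul_smul, smul_eq_mul, mul_inv, mul_inv_cancel_left₀ hx]
    obtain ⟨G, hG, hFG⟩ := Nat.sInf_mem hmem
    rw [poleOrder, if_pos hroot]
    exact exists_isLaurentExpansion hG hFG
  · have hd : (1 - laplace μ l).det ≠ 0 := fun h0 => hroot ⟨hl, h0⟩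
    rw [poleOrder, if_neg hroot]
    exact exists_isLaurentExpansion (analyticAt_laplaceResolvent hL hd)
      (Eventually.of_forall fun w => by simp)

/-! ### Symmetry under complex conjugation -/

theorem laplace_conj (μ : MeasureMatrix p) (z : ℂ) :
    laplace μ (starRingEnd ℂ z) = (laplace μ z).map (starRingEnd ℂ) := by
  ext i j
  simp only [laplace, Matrix.of_apply, Matrix.map_apply]
  rw [← integral_conj]
  congr 1
  funext x
  rw [← Complex.exp_conj]
  simp

theorem det_one_sub_laplace_conj (μ : MeasureMatrix p) (z : ℂ) :
    (1 - laplace μ (starRingEnd ℂ z)).det = starRingEnd ℂ (1 - laplace μ z).det := by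
  rw [laplace_conj, RingHom.map_det]
  congr 1
  ext i j
  simp [Matrix.one_apply]

theorem laplaceResolvent_conj (μ : MeasureMatrix p) (z : ℂ) :
    laplaceResolvent μ (starRingEnd ℂ z) = (laplaceResolvent μ z).map (starRingEnd ℂ) := by
  have h : 1 - laplace μ (starRingEnd ℂ z) = (starRingEnd ℂ).mapMatrix (1 - laplace μ z) := by
    rw [laplace_conj]; ext i j; simp [Matrix.one_apply]
  rw [laplaceResolvent_eq, laplaceResolvent_eq, det_one_sub_laplace_conj, h, ← RingHom.map_adjugate]
  ext i j
  simp

theorem conj_mem_laplaceDomain {μ : MeasureMatrix p} {z : ℂ} (hz : z ∈ laplaceDomain μ) :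
    starRingEnd ℂ z ∈ laplaceDomain μ := laplaceDomain_mono hz (by simp)

theorem conj_mem_roots {μ : MeasureMatrix p} {z : ℂ} (hz : z ∈ roots μ) :
    starRingEnd ℂ z ∈ roots μ :=
  ⟨conj_mem_laplaceDomain hz.1, by rw [det_one_sub_laplace_conj, hz.2, map_zero]⟩

theorem analyticAt_conj_conj {g : ℂ → ℂ} {l : ℂ} (hg : AnalyticAt ℂ g l) :
    AnalyticAt ℂ (fun w => starRingEnd ℂ (g (starRingEnd ℂ w))) (starRingEnd ℂ l) := by
  rw [Complex.analyticAt_iff_eventually_differentiableAt] at hg ⊢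
  have h : Tendsto (starRingEnd ℂ) (𝓝 (starRingEnd ℂ l)) (𝓝 l) := by
    simpa using (Complex.continuous_conj.tendsto (starRingEnd ℂ l))
  filter_upwards [h.eventually hg] with w hw
  have := hw.conj_conj
  rwa [Complex.conj_conj] at this

theorem tendsto_conj_punctured (l : ℂ) :
    Tendsto (starRingEnd ℂ) (𝓝[≠] (starRingEnd ℂ l)) (𝓝[≠] l) := by
  refine tendsto_nhdsWithin_of_tendsto_nhds_of_eventually_within _ ?_ ?_
  · have h : Tendsto (starRingEnd ℂ) (𝓝 (starRingEnd ℂ l)) (𝓝 l) := by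
      simpa using (Complex.continuous_conj.tendsto (starRingEnd ℂ l))
    exact h.mono_left nhdsWithin_le_nhds
  · filter_upwards [self_mem_nhdsWithin] with w hw h
    exact hw (by rw [← Set.mem_singleton_iff.mp h]; simp)

theorem poleOrder_conj (μ : MeasureMatrix p) (z : ℂ) :
    poleOrder μ (starRingEnd ℂ z) = poleOrder μ z := by
  have key : ∀ z n, (∃ G : ℂ → Matrix (Fin p) (Fin p) ℂ,
      (∀ i j, AnalyticAt ℂ (fun w => G w i j) z) ∧
      ∀ᶠ w in 𝓝[≠] z, (w - z) ^ n • laplaceResolvent μ w = G w) →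
      ∃ G : ℂ → Matrix (Fin p) (Fin p) ℂ,
      (∀ i j, AnalyticAt ℂ (fun w => G w i j) (starRingEnd ℂ z)) ∧
      ∀ᶠ w in 𝓝[≠] (starRingEnd ℂ z), (w - starRingEnd ℂ z) ^ n • laplaceResolvent μ w = G w := by
    rintro z n ⟨G, hG, hGw⟩
    refine ⟨fun w => (G (starRingEnd ℂ w)).map (starRingEnd ℂ), fun i j => ?_, ?_⟩
    · exact analyticAt_conj_conj (hG i j)
    · filter_upwards [(tendsto_conj_punctured z).eventually hGw] with w hw
      rw [← hw, laplaceResolvent_conj]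
      ext i j
      simp
  have hroots : starRingEnd ℂ z ∈ roots μ ↔ z ∈ roots μ :=
    ⟨fun h => by simpa using conj_mem_roots h, conj_mem_roots⟩
  rw [poleOrder, poleOrder]
  by_cases hz : z ∈ roots μ
  · rw [if_pos hz, if_pos (hroots.mpr hz)]
    congr 1
    ext n
    exact ⟨fun h => by simpa using key _ n h, key z n⟩
  · rw [if_neg hz, if_neg fun h => hz (hroots.mp h)]

theorem IsLaurentExpansion.conj {F : ℂ → Matrix (Fin p) (Fin p) ℂ} {l : ℂ} {m : ℕ}
    {A : ℕ → Matrix (Fin p) (Fin p) ℂ} (h : IsLaurentExpansion F l m A)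
    (hF : ∀ w, F (starRingEnd ℂ w) = (F w).map (starRingEnd ℂ)) :
    IsLaurentExpansion F (starRingEnd ℂ l) m fun k => (A k).map (starRingEnd ℂ) := by
  obtain ⟨H, hH, hHl, hFw⟩ := h
  refine ⟨fun w => (H (starRingEnd ℂ w)).map (starRingEnd ℂ),
    fun i j => analyticAt_conj_conj (hH i j), by simp [hHl], ?_⟩
  filter_upwards [(tendsto_conj_punctured l).eventually hFw] with w hw
  have h1 := hF (starRingEnd ℂ w)
  rw [Complex.conj_conj, hw] at h1
  rw [h1]
  ext i j
  simp [Matrix.sum_apply]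

/-- Averaging an expansion with its conjugate yields symmetric coefficients without any appeal to
uniqueness. -/
theorem IsLaurentExpansion.average {F : ℂ → Matrix (Fin p) (Fin p) ℂ} {l : ℂ} {m : ℕ}
    {A B : ℕ → Matrix (Fin p) (Fin p) ℂ} (hA : IsLaurentExpansion F l m A)
    (hB : IsLaurentExpansion F l m B) :
    IsLaurentExpansion F l m fun k => (2⁻¹ : ℂ) • (A k + B k) := by
  obtain ⟨H, hH, hHl, hFw⟩ := hA
  obtain ⟨K, hK, hKl, hFw'⟩ := hB
  refine ⟨fun w => (2⁻¹ : ℂ) • (H w + K w), fun i j => ?_, by simp [hHl, hKl], ?_⟩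
  · simp only [Matrix.smul_apply, Matrix.add_apply, smul_eq_mul]
    exact analyticAt_const.mul ((hH i j).add (hK i j))
  · filter_upwards [hFw, hFw'] with w h1 h2
    have : F w = (2⁻¹ : ℂ) • (F w + F w) := by
      rw [← two_smul ℂ (F w), smul_smul]; simp
    rw [this]
    nth_rewrite 1 [h1]
    nth_rewrite 1 [h2]
    simp_rw [smul_add, Finset.sum_add_distrib, Finset.smul_sum, smul_comm (2⁻¹ : ℂ)]
    abel

/-- The Laurent coefficients of `(1 - ℒμ)⁻¹` can be chosen compatibly with complex conjugation. -/
theorem exists_symmetric_laurent {μ : MeasureMatrix p} {S : Set ℂ}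
    (hS : ∀ l ∈ S, starRingEnd ℂ l ∈ S)
    (h : ∀ l ∈ S, ∃ A, IsLaurentExpansion (laplaceResolvent μ) l (poleOrder μ l) A) :
    ∃ A : ℂ → ℕ → Matrix (Fin p) (Fin p) ℂ,
      (∀ l ∈ S, IsLaurentExpansion (laplaceResolvent μ) l (poleOrder μ l) (A l)) ∧
      ∀ l k, A (starRingEnd ℂ l) k = (A l k).map (starRingEnd ℂ) := by
  choose! A₀ hA₀ using h
  refine ⟨fun l k => (2⁻¹ : ℂ) • (A₀ l k + (A₀ (starRingEnd ℂ l) k).map (starRingEnd ℂ)),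
    fun l hl => ?_, fun l k => ?_⟩
  · refine (hA₀ l hl).average ?_
    have := (hA₀ _ (hS l hl)).conj (laplaceResolvent_conj μ)
    rwa [Complex.conj_conj, poleOrder_conj] at this
  · ext i j
    simp [map_ofNat, mul_add, add_comm]

/-- Partial fractions for `(w - l)^{-q} / w`. -/
theorem inv_pow_div_eq {l w : ℂ} (hl : l ≠ 0) (hw : w ≠ 0) (hwl : w - l ≠ 0) (q : ℕ) :
    ((w - l) ^ q)⁻¹ / w = ∑ n ∈ Finset.range q, (-1) ^ n / l ^ (n + 1) * ((w - l) ^ (q - n))⁻¹ +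
      (-1) ^ q / (l ^ q * w) := by
  induction q with
  | zero => simp
  | succ q ih =>
    have h1 : ((w - l) ^ (q + 1))⁻¹ / w = (w - l)⁻¹ * (((w - l) ^ q)⁻¹ / w) := by
      rw [pow_succ']; field_simp
    rw [h1, ih, mul_add, Finset.sum_range_succ, Finset.mul_sum, add_assoc]
    congr 1
    · refine Finset.sum_congr rfl fun n hn => ?_
      have : q + 1 - n = (q - n) + 1 := by have := Finset.mem_range.mp hn; omega
      rw [this, pow_succ' _ (q - n), mul_inv]
      ring
    · simp only [add_tsub_cancel_left, pow_one]
      field_simp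
      ring

/-- The principal part of `F w / w` at a nonzero point. -/
theorem IsLaurentExpansion.div_self_of_ne_zero {F : ℂ → Matrix (Fin p) (Fin p) ℂ} {l : ℂ} {m : ℕ}
    {A : ℕ → Matrix (Fin p) (Fin p) ℂ} (h : IsLaurentExpansion F l m A) (hl : l ≠ 0)
    (i j : Fin p) :
    ∃ g : ℂ → ℂ, AnalyticAt ℂ g l ∧ ∀ᶠ w in 𝓝[≠] l, F w i j / w =
      ∑ k ∈ Finset.range m, (∑ n ∈ Finset.range (m - k),
        (-1) ^ n / l ^ (n + 1) * A (n + k + 1) i j) / (w - l) ^ (k + 1) + g w := by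
  obtain ⟨H, hH, hHl, hFw⟩ := h
  -- The regular part collects the last terms of the partial fractions, which are singular only at
  -- `0 ≠ l`.
  refine ⟨fun w => ∑ q ∈ Finset.range m, A (q + 1) i j * ((-1) ^ (q + 1) / (l ^ (q + 1) * w)) +
    H w i j / w, ?_, ?_⟩
  · refine AnalyticAt.add (Finset.analyticAt_fun_sum _ fun q _ => ?_) ((hH i j).div analyticAt_id hl)
    exact analyticAt_const.mul (analyticAt_const.div (analyticAt_const.mul analyticAt_id)
      (mul_ne_zero (pow_ne_zero _ hl) hl))
  · filter_upwards [hFw, self_mem_nhdsWithin,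
      (eventually_ne_nhds hl).filter_mono nhdsWithin_le_nhds] with w hw hwl hw0
    have hx : w - l ≠ 0 := sub_ne_zero.mpr hwl
    have e1 : ∑ k ∈ Finset.Icc 1 m, ((w - l) ^ k)⁻¹ * A k i j =
        ∑ q ∈ Finset.range m, ((w - l) ^ (q + 1))⁻¹ * A (q + 1) i j := by
      rw [Finset.range_eq_Ico, Finset.sum_Ico_add' (fun k => ((w - l) ^ k)⁻¹ * A k i j) 0 m 1]
      rfl
    have e2 : ∀ q, ((w - l) ^ (q + 1))⁻¹ * A (q + 1) i j / w =
        ∑ a ∈ Finset.range (q + 1), (-1) ^ (q - a) / l ^ (q - a + 1) *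
          A (q - a + a + 1) i j / (w - l) ^ (a + 1) +
        A (q + 1) i j * ((-1) ^ (q + 1) / (l ^ (q + 1) * w)) := by
      intro q
      have := inv_pow_div_eq hl hw0 hx (q + 1)
      rw [mul_div_right_comm, this, add_mul, mul_comm (A (q + 1) i j), Finset.sum_mul]
      congr 1
      rw [← Finset.sum_range_reflect]
      refine Finset.sum_congr rfl fun a ha => ?_
      have ha' : a ≤ q := Nat.lt_succ_iff.mp (Finset.mem_range.mp ha)
      have i1 : q + 1 - 1 - a = q - a := by omega
      have i2 : q + 1 - (q - a) = a + 1 := by omega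
      have i3 : q - a + a + 1 = q + 1 := by omega
      rw [i1, i2, i3]
      ring
    rw [hw, Matrix.add_apply, Matrix.sum_apply, add_div]
    simp only [Matrix.smul_apply, smul_eq_mul]
    rw [e1, Finset.sum_div, ← add_assoc]
    congr 1
    simp_rw [e2]
    rw [Finset.sum_add_distrib]
    congr 1
    -- Exchange of the order of summation: terms are grouped by the power `a + 1` of `(w - l)⁻¹`
    -- instead of by the Laurent index.
    rw [Finset.sum_range_diag_flip m fun a n => (-1) ^ n / l ^ (n + 1) *
          A (n + a + 1) i j / (w - l) ^ (a + 1)]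
    simp_rw [Finset.sum_div]

/-- The principal part of `F w / w` at zero. -/
theorem IsLaurentExpansion.div_self_zero {F : ℂ → Matrix (Fin p) (Fin p) ℂ} {m : ℕ}
    {A : ℕ → Matrix (Fin p) (Fin p) ℂ} (h : IsLaurentExpansion F 0 m A) (i j : Fin p) :
    ∃ g : ℂ → ℂ, AnalyticAt ℂ g 0 ∧ ∀ᶠ w in 𝓝[≠] (0 : ℂ), F w i j / w =
      ∑ k ∈ Finset.range (m + 1), A k i j / w ^ (k + 1) + g w := by
  obtain ⟨H, hH, hHl, hFw⟩ := h
  -- `H(w)/w = H(0)/w + dslope H 0 w`, so `A 0 = H(0)` joins the principal part and the pole order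
  -- grows by one.
  refine ⟨dslope (fun w => H w i j) 0, analyticAt_dslope (hH i j), ?_⟩
  filter_upwards [hFw, self_mem_nhdsWithin] with w hw hw0
  have hw0' : w ≠ 0 := hw0
  have e1 : ∑ k ∈ Finset.Icc 1 m, (w ^ k)⁻¹ * A k i j =
      ∑ q ∈ Finset.range m, (w ^ (q + 1))⁻¹ * A (q + 1) i j := by
    rw [Finset.range_eq_Ico, Finset.sum_Ico_add' (fun k => (w ^ k)⁻¹ * A k i j) 0 m 1]
    rfl
  rw [hw, Matrix.add_apply, Matrix.sum_apply, add_div, Finset.sum_range_succ', dslope_of_ne _ hw0',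
    slope_def_field, hHl]
  simp only [Matrix.smul_apply, smul_eq_mul, sub_zero]
  rw [e1, Finset.sum_div, sub_div, zero_add, pow_one, add_assoc, add_sub_cancel]
  congr 1
  refine Finset.sum_congr rfl fun q _ => ?_
  rw [pow_succ _ (q + 1)]
  field_simp

end Laurent

end MarkovRenewal

namespace MarkovRenewal

/-! ### Transforms of exponential polynomials -/

section Transform

-- Induction: `t^{k+1}/(k+1)` is the cumulative function of `t^k`, and passing to it divides the
-- transform by `w`.
open Complex in
theorem laplace_pow {w : ℂ} (hw : 0 < w.re) (k : ℕ) :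
    IntegrableOn (fun t : ℝ => cexp (-w * t) * (t : ℂ) ^ k) (Set.Ioi 0) ∧
    ∫ t in Set.Ioi (0 : ℝ), cexp (-w * t) * (t : ℂ) ^ k = k.factorial / w ^ (k + 1) := by
  have hw0 : w ≠ 0 := by rintro rfl; simp at hw
  induction k with
  | zero =>
    simp only [pow_zero, mul_one]
    refine ⟨integrableOn_exp_mul_complex_Ioi (by simpa using hw) 0, ?_⟩
    rw [integral_exp_mul_complex_Ioi (by simpa using hw) 0]
    simp [neg_div]
  | succ k ih =>
    have hcum := laplace_cumulative (ν := volume.restrict (Set.Ioi 0)) (f := fun x => (x : ℂ) ^ k)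
      hw ih.1
    have hpos : ∀ t : ℝ, 0 < t → ∫ x in Set.Iic t, (x : ℂ) ^ k ∂(volume.restrict (Set.Ioi 0)) =
        (t : ℂ) ^ (k + 1) / (k + 1) := by
      intro t ht
      rw [Measure.restrict_restrict measurableSet_Iic, Set.Iic_inter_Ioi,
        ← intervalIntegral.integral_of_le ht.le]
      have := integral_pow (a := 0) (b := t) k
      have h2 : ∫ x in (0 : ℝ)..t, (x : ℂ) ^ k = ((∫ x in (0 : ℝ)..t, x ^ k : ℝ) : ℂ) := by
        rw [← intervalIntegral.integral_ofReal]; simp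
      rw [h2, this]
      simp
    have hneg : ∀ t : ℝ, t ≤ 0 → ∫ x in Set.Iic t, (x : ℂ) ^ k ∂(volume.restrict (Set.Ioi 0)) = 0 := by
      intro t ht
      rw [Measure.restrict_restrict measurableSet_Iic, Set.Iic_inter_Ioi, Set.Ioc_eq_empty (by simpa)]
      simp
    have hk : ((k : ℂ) + 1) ≠ 0 := by exact_mod_cast k.succ_ne_zero
    have e : ∀ t ∈ Set.Ioi (0 : ℝ), cexp (-w * t) * (t : ℂ) ^ (k + 1) =
        (k + 1) * (cexp (-w * t) *
          ∫ x in Set.Iic t, (x : ℂ) ^ k ∂(volume.restrict (Set.Ioi 0))) := by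
      intro t ht
      rw [hpos t ht]
      field_simp
    constructor
    · exact IntegrableOn.congr_fun (hcum.1.integrableOn.const_mul _) (fun t ht => (e t ht).symm)
        measurableSet_Ioi
    · rw [setIntegral_congr_fun measurableSet_Ioi e, integral_const_mul,
        setIntegral_eq_integral_of_forall_compl_eq_zero, hcum.2, ih.2, Nat.factorial_succ]
      · push_cast
        field_simp
        ring
      · intro t ht
        rw [hneg t (by simpa using ht), mul_zero]

/-- `m` is smooth with at most exponential growth, its Laplace transform on `Re z = c` is `Q`, and
`Q` decays like `|Im z|⁻¹`. -/
structure HasRegularTransform (c : ℝ) (m : ℝ → ℂ) (Q : ℂ → ℂ) : Prop where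
  differentiable : ∀ t, DifferentiableAt ℝ m t
  growth : ∃ B K : ℝ, 0 ≤ B ∧
    ∀ t, 0 ≤ t → ‖m t‖ ≤ B * Real.exp (K * t) ∧ ‖deriv m t‖ ≤ B * Real.exp (K * t)
  integrable : ∀ z : ℂ, z.re = c →
    IntegrableOn (fun t : ℝ => Complex.exp (-z * t) * m t) (Set.Ioi 0)
  transform : ∀ z : ℂ, z.re = c → ∫ t in Set.Ioi (0 : ℝ), Complex.exp (-z * t) * m t = Q z
  decay : ∃ C T : ℝ, ∀ z : ℂ, T ≤ |z.im| → ‖Q z‖ ≤ C * (1 + z.im ^ 2) ^ (-1 / 2 : ℝ)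

theorem HasRegularTransform.zero (c : ℝ) : HasRegularTransform c (fun _ => 0) fun _ => 0 where
  differentiable _ := differentiableAt_const _
  growth := ⟨0, 0, le_rfl, by simp⟩
  integrable _ _ := by simp
  transform _ _ := by simp
  decay := ⟨0, 0, by simp⟩

theorem HasRegularTransform.add {c : ℝ} {m₁ m₂ : ℝ → ℂ} {Q₁ Q₂ : ℂ → ℂ}
    (h₁ : HasRegularTransform c m₁ Q₁) (h₂ : HasRegularTransform c m₂ Q₂) :
    HasRegularTransform c (fun t => m₁ t + m₂ t) fun z => Q₁ z + Q₂ z where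
  differentiable t := (h₁.differentiable t).add (h₂.differentiable t)
  growth := by
    obtain ⟨B₁, K₁, hB₁, hg₁⟩ := h₁.growth
    obtain ⟨B₂, K₂, hB₂, hg₂⟩ := h₂.growth
    refine ⟨B₁ + B₂, max K₁ K₂, by positivity, fun t ht => ?_⟩
    have e1 : Real.exp (K₁ * t) ≤ Real.exp (max K₁ K₂ * t) := by gcongr; exact le_max_left _ _
    have e2 : Real.exp (K₂ * t) ≤ Real.exp (max K₁ K₂ * t) := by gcongr; exact le_max_right _ _
    rw [deriv_fun_add (h₁.differentiable t) (h₂.differentiable t), add_mul]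
    exact ⟨(norm_add_le _ _).trans (add_le_add ((hg₁ t ht).1.trans (by gcongr))
        ((hg₂ t ht).1.trans (by gcongr))),
      (norm_add_le _ _).trans (add_le_add ((hg₁ t ht).2.trans (by gcongr))
        ((hg₂ t ht).2.trans (by gcongr)))⟩
  integrable z hz := by
    simp_rw [mul_add]
    exact (h₁.integrable z hz).add (h₂.integrable z hz)
  transform z hz := by
    simp_rw [mul_add]
    rw [integral_add (h₁.integrable z hz) (h₂.integrable z hz), h₁.transform z hz,
      h₂.transform z hz]
  decay := by
    obtain ⟨C₁, T₁, hd₁⟩ := h₁.decay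
    obtain ⟨C₂, T₂, hd₂⟩ := h₂.decay
    refine ⟨C₁ + C₂, max T₁ T₂, fun z hz => ?_⟩
    rw [add_mul]
    exact (norm_add_le _ _).trans (add_le_add (hd₁ z ((le_max_left _ _).trans hz))
      (hd₂ z ((le_max_right _ _).trans hz)))

theorem HasRegularTransform.const_mul {c : ℝ} {m : ℝ → ℂ} {Q : ℂ → ℂ}
    (h : HasRegularTransform c m Q) (a : ℂ) :
    HasRegularTransform c (fun t => a * m t) fun z => a * Q z where
  differentiable t := (h.differentiable t).const_mul a
  growth := by
    obtain ⟨B, K, hB, hg⟩ := h.growth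
    refine ⟨‖a‖ * B, K, by positivity, fun t ht => ?_⟩
    rw [deriv_const_mul a (h.differentiable t), norm_mul, norm_mul, mul_assoc]
    exact ⟨by gcongr; exact (hg t ht).1, by gcongr; exact (hg t ht).2⟩
  integrable z hz := by
    simp_rw [mul_left_comm _ a]
    exact (h.integrable z hz).const_mul a
  transform z hz := by
    simp_rw [mul_left_comm _ a]
    rw [integral_const_mul, h.transform z hz]
  decay := by
    obtain ⟨C, T, hd⟩ := h.decay
    refine ⟨‖a‖ * C, T, fun z hz => ?_⟩
    rw [norm_mul, mul_assoc]
    gcongr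
    exact hd z hz

theorem HasRegularTransform.sum {ι : Type*} {c : ℝ} {m : ι → ℝ → ℂ} {Q : ι → ℂ → ℂ} (s : Finset ι)
    (h : ∀ a ∈ s, HasRegularTransform c (m a) (Q a)) :
    HasRegularTransform c (fun t => ∑ a ∈ s, m a t) fun z => ∑ a ∈ s, Q a z := by
  classical
  induction s using Finset.induction_on with
  | empty => simpa using HasRegularTransform.zero c
  | insert a s ha ih =>
    simp_rw [Finset.sum_insert ha]
    exact (h a (Finset.mem_insert_self a s)).add
      (ih fun b hb => h b (Finset.mem_insert_of_mem hb))

theorem inv_abs_le_rpow {y : ℝ} (hy : 1 ≤ |y|) : |y|⁻¹ ≤ 2 * (1 + y ^ 2) ^ (-1 / 2 : ℝ) := by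
  have h1 : √(1 + y ^ 2) ≤ 2 * |y| := by
    apply Real.sqrt_le_iff.mpr
    refine ⟨by positivity, ?_⟩
    nlinarith [sq_abs y]
  rw [neg_div, Real.rpow_neg (by positivity), ← Real.sqrt_eq_rpow, ← div_eq_mul_inv,
    inv_le_comm₀ (by linarith) (by positivity), inv_div, div_le_iff₀ (by positivity)]
  linarith

open Complex in
theorem hasRegularTransform_pow_mul_exp {c : ℝ} {l : ℂ} (hl : l.re < c) (k : ℕ) :
    HasRegularTransform c (fun t => (t : ℂ) ^ k * cexp (l * t))
      fun z => k.factorial / (z - l) ^ (k + 1) := by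
  have e : ∀ (z : ℂ) (t : ℝ), cexp (-z * t) * ((t : ℂ) ^ k * cexp (l * t)) =
      cexp (-(z - l) * t) * (t : ℂ) ^ k := by
    intro z t
    rw [mul_left_comm, ← Complex.exp_add, mul_comm]
    congr 2; ring
  have hd : ∀ t : ℝ, HasDerivAt (fun t : ℝ => (t : ℂ) ^ k * cexp (l * t))
      (k * (t : ℂ) ^ (k - 1) * cexp (l * t) + (t : ℂ) ^ k * (cexp (l * t) * l)) t := by
    intro t
    have h1 := (hasDerivAt_pow k (t : ℂ)).comp_ofReal
    have h2 := ((hasDerivAt_id (t : ℂ)).const_mul l).cexp.comp_ofReal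
    simpa using h1.fun_mul h2
  have hpow : ∀ (n : ℕ) (t : ℝ), 0 ≤ t → t ^ n ≤ n.factorial * Real.exp t := by
    intro n t ht
    have := Real.pow_div_factorial_le_exp t ht n
    rw [div_le_iff₀ (by positivity)] at this
    linarith
  refine ⟨fun t => (hd t).differentiableAt, ?_, fun z hz => ?_, fun z hz => ?_, ?_⟩
  · refine ⟨k * (k - 1).factorial + k.factorial * (1 + ‖l‖), 1 + l.re, by positivity,
      fun t ht => ?_⟩
    have hn : ‖cexp (l * t)‖ = Real.exp (l.re * t) := by rw [Complex.norm_exp]; simp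
    have hexp : Real.exp ((1 + l.re) * t) = Real.exp t * Real.exp (l.re * t) := by
      rw [← Real.exp_add]; congr 1; ring
    have hnp : ∀ n : ℕ, ‖(t : ℂ) ^ n‖ = t ^ n := by
      intro n; rw [norm_pow, Complex.norm_real, Real.norm_of_nonneg ht]
    have h1 : t ^ k * Real.exp (l.re * t) ≤ k.factorial * Real.exp ((1 + l.re) * t) := by
      rw [hexp, ← mul_assoc]; gcongr; exact hpow k t ht
    have h2 : t ^ (k - 1) * Real.exp (l.re * t) ≤
        (k - 1).factorial * Real.exp ((1 + l.re) * t) := by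
      rw [hexp, ← mul_assoc]; gcongr; exact hpow (k - 1) t ht
    constructor
    · rw [norm_mul, hnp, hn]
      refine h1.trans ?_
      gcongr
      have : (0 : ℝ) ≤ k * (k - 1).factorial := by positivity
      nlinarith [norm_nonneg l, (by positivity : (0 : ℝ) < k.factorial),
        mul_nonneg (by positivity : (0 : ℝ) ≤ k.factorial) (norm_nonneg l)]
    · rw [(hd t).deriv]
      refine (norm_add_le _ _).trans ?_
      simp only [norm_mul, hnp, hn, Complex.norm_natCast]
      have h3 : (k : ℝ) * t ^ (k - 1) * Real.exp (l.re * t) ≤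
          k * ((k - 1).factorial * Real.exp ((1 + l.re) * t)) := by
        rw [mul_assoc]; gcongr
      have h4 : t ^ k * (Real.exp (l.re * t) * ‖l‖) ≤
          (k.factorial * Real.exp ((1 + l.re) * t)) * ‖l‖ := by
        rw [← mul_assoc]; gcongr
      have h5 : (0 : ℝ) ≤ k.factorial * Real.exp ((1 + l.re) * t) := by positivity
      nlinarith
  · simp_rw [e]
    exact (laplace_pow (by simpa [hz] using hl) k).1
  · simp_rw [e]
    exact (laplace_pow (by simpa [hz] using hl) k).2
  -- From this height on `‖z - l‖ ≥ |Im z|/2 ≥ 1`, so the power `k + 1` decays at least as fast as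
  -- the first power.
  · refine ⟨k.factorial * 4, 2 * |l.im| + 2, fun z hz => ?_⟩
    have h1 : |z.im| / 2 ≤ ‖z - l‖ := by
      have h2 := abs_im_le_norm (z - l)
      rw [sub_im] at h2
      have h3 := abs_sub_abs_le_abs_sub z.im l.im
      linarith [abs_nonneg l.im]
    have hz1 : 1 ≤ |z.im| / 2 := by linarith [abs_nonneg l.im]
    have h4 : ‖z - l‖ ≤ ‖z - l‖ ^ (k + 1) := le_self_pow₀ (hz1.trans h1) k.succ_ne_zero
    rw [norm_div, norm_pow, Complex.norm_natCast, div_eq_mul_inv, mul_assoc]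
    gcongr
    calc (‖z - l‖ ^ (k + 1))⁻¹ ≤ (|z.im| / 2)⁻¹ := by
          apply inv_anti₀ (by linarith) (h1.trans h4)
      _ = 2 * |z.im|⁻¹ := by rw [inv_div]; ring
      _ ≤ 2 * (2 * (1 + z.im ^ 2) ^ (-1 / 2 : ℝ)) := by
          gcongr; exact inv_abs_le_rpow (by linarith)
      _ = _ := by ring

/-- Removal of finitely many removable singularities. -/
theorem exists_analytic_extension {f : ℂ → ℂ} {Ω : Set ℂ} {S : Finset ℂ}
    (hf : ∀ z ∈ Ω, z ∉ S → AnalyticAt ℂ f z)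
    (hS : ∀ z ∈ Ω, z ∈ S → ∃ g : ℂ → ℂ, AnalyticAt ℂ g z ∧ ∀ᶠ w in 𝓝[≠] z, f w = g w) :
    ∃ D : ℂ → ℂ, (∀ z ∈ Ω, AnalyticAt ℂ D z) ∧ ∀ z ∉ S, D z = f z := by
  classical
  choose! g hg hfg using hS
  have hev : ∀ z : ℂ, ∀ᶠ w in 𝓝[≠] z, w ∉ S := by
    intro z
    have h1 : ((S : Set ℂ) \ {z})ᶜ ∈ 𝓝 z :=
      (S.finite_toSet.subset Set.sdiff_subset).isClosed.isOpen_compl.mem_nhds (by simp)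
    filter_upwards [mem_nhdsWithin_of_mem_nhds h1, self_mem_nhdsWithin] with w hw hwz hwS
    exact hw ⟨hwS, hwz⟩
  refine ⟨fun z => if z ∈ S then g z z else f z, fun z hz => ?_, fun z hz => if_neg hz⟩
  by_cases hzS : z ∈ S
  · refine (hg z hz hzS).congr ?_
    filter_upwards [eventually_nhdsWithin_iff.mp (hev z),
      eventually_nhdsWithin_iff.mp (hfg z hz hzS)] with w hw hw'
    rcases eq_or_ne w z with rfl | hwz
    · rw [if_pos hzS]
    · rw [if_neg (hw hwz), hw' hwz]
  · refine (hf z hz hzS).congr ?_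
    have : ∀ᶠ w in 𝓝 z, w ∉ S := S.finite_toSet.isClosed.isOpen_compl.mem_nhds hzS
    filter_upwards [this] with w hw
    rw [if_neg hw]

end Transform

/-! ### Bounds for the resolvent on strips -/

section Resolvent

variable {p : ℕ}

theorem analyticAt_laplace {μ : MeasureMatrix p} {θ₀ : ℝ} (h : (θ₀ : ℂ) ∈ laplaceDomain μ) {z : ℂ}
    (hz : θ₀ < z.re) (i j : Fin p) : AnalyticAt ℂ (fun w => laplace μ w i j) z := by
  have e : (fun w => laplace μ w i j) =
      ProbabilityTheory.complexMGF (fun x : ℝ≥0 => -(x : ℝ)) (μ i j) := by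
    funext w
    simp [laplace, ProbabilityTheory.complexMGF]
  rw [e]
  refine ProbabilityTheory.analyticAt_complexMGF ?_
  refine mem_interior.mpr ⟨Set.Ioi θ₀, fun s hs => ?_, isOpen_Ioi, hz⟩
  have h1 := (mem_laplaceDomain_iff.mp (laplaceDomain_mono (w := (s : ℂ)) h
    (by simpa using le_of_lt hs)) i j).norm
  refine h1.congr (Eventually.of_forall fun x => ?_)
  simp [Complex.norm_exp]

theorem norm_det_le {M : Matrix (Fin p) (Fin p) ℂ} {b : ℝ} (h : ∀ i j, ‖M i j‖ ≤ b) :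
    ‖M.det‖ ≤ p.factorial * b ^ p := by
  have := Matrix.det_le (abv := IsAbsoluteValue.toAbsoluteValue (norm : ℂ → ℝ)) (A := M) (x := b) h
  simpa using this

/-- Each entry is the determinant of the matrix with one row replaced by a unit vector, hence `1 ≤
b`. -/
theorem norm_adjugate_le {M : Matrix (Fin p) (Fin p) ℂ} {b : ℝ} (hb : 1 ≤ b)
    (h : ∀ i j, ‖M i j‖ ≤ b) (i j : Fin p) : ‖M.adjugate i j‖ ≤ p.factorial * b ^ p := by
  rw [Matrix.adjugate_apply]
  refine norm_det_le fun i' j' => ?_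
  rw [Matrix.updateRow_apply]
  split_ifs
  · rw [Pi.single_apply]
    split_ifs
    · simpa using hb
    · simpa using zero_le_one.trans hb
  · exact h _ _

theorem exists_norm_laplace_le {μ : MeasureMatrix p} {θ₀ : ℝ} (h : (θ₀ : ℂ) ∈ laplaceDomain μ) :
    ∃ b : ℝ, ∀ z : ℂ, θ₀ ≤ z.re → ∀ i j, ‖laplace μ z i j‖ ≤ b := by
  set f : Fin p → Fin p → ℝ := fun i j =>
    ∫ x : ℝ≥0, ‖Complex.exp (-(θ₀ : ℂ) * ((x : ℝ) : ℂ))‖ ∂(μ i j) with hf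
  have hf0 : ∀ i j, 0 ≤ f i j := fun i j => integral_nonneg fun _ => norm_nonneg _
  refine ⟨∑ i, ∑ j, f i j, fun z hz i j => ?_⟩
  have h1 : ‖laplace μ z i j‖ ≤ f i j := by
    refine norm_integral_le_of_norm_le (mem_laplaceDomain_iff.mp h i j).norm
      (Eventually.of_forall fun x => ?_)
    rw [Complex.norm_exp, Complex.norm_exp]
    simp only [Complex.mul_re, Complex.neg_re, Complex.ofReal_re, Complex.ofReal_im, mul_zero,
      sub_zero]
    gcongr
  calc _ ≤ f i j := h1
    _ ≤ ∑ j, f i j := Finset.single_le_sum (f := fun j => f i j) (fun _ _ => hf0 _ _)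
        (Finset.mem_univ j)
    _ ≤ _ := Finset.single_le_sum (f := fun i => ∑ j, f i j)
        (fun _ _ => Finset.sum_nonneg fun _ _ => hf0 _ _) (Finset.mem_univ i)

/-- `det X · det R = 1`, and a bounded inverse `R` has bounded determinant. -/
theorem exists_lower_bound_det {ι : Type*} {X R : ι → Matrix (Fin p) (Fin p) ℂ} {b : ℝ}
    (hXR : ∀ a, X a * R a = 1) (hR : ∀ a i j, ‖R a i j‖ ≤ b) :
    ∃ δ : ℝ, 0 < δ ∧ ∀ a, δ ≤ ‖(X a).det‖ := by
  refine ⟨(|p.factorial * b ^ p| + 1)⁻¹, by positivity, fun a => ?_⟩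
  have h1 : ‖(X a).det‖ * ‖(R a).det‖ = 1 := by
    rw [← norm_mul, ← Matrix.det_mul, hXR, Matrix.det_one, norm_one]
  have h2 : ‖(R a).det‖ ≤ |p.factorial * b ^ p| + 1 :=
    (norm_det_le (hR a)).trans ((le_abs_self _).trans (by linarith))
  rw [inv_le_iff_one_le_mul₀ (by positivity)]
  exact h1.symm.le.trans (by gcongr)

open scoped Matrix.Norms.Operator in
/-- The resolvent `(1 - ℒμ)⁻¹` is bounded, away from a compact set, on a vertical strip slightly
larger than the one between the line of the assumption and a line far to the right. -/
theorem exists_resolvent_bound {μ : MeasureMatrix p} [∀ i j, SFinite (μ i j)] {θ₀ θ c ρ : ℝ}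
    (hθ₀ : (θ₀ : ℂ) ∈ laplaceDomain μ) (h0 : θ₀ < θ) (hθc : θ < c) (hρ : 0 < ρ)
    (hc : (c : ℂ) ∈ laplaceDomain (renewalMeasure μ))
    (hres : ResolventBoundedOnLine μ θ) (hfin : (rootsAbove μ θ).Finite) :
    ∃ r : ℝ, 0 < r ∧ r ≤ ρ ∧ θ₀ < θ - r ∧
      (∀ z : ℂ, |z.re - θ| ≤ r → (1 - laplace μ z).det ≠ 0) ∧
      ∃ T B : ℝ, ∀ z : ℂ, θ - r ≤ z.re → z.re ≤ c → T ≤ |z.im| →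
        ∀ i j, ‖laplaceResolvent μ z i j‖ ≤ B := by
  have hdom : ∀ z : ℂ, θ₀ ≤ z.re → z ∈ laplaceDomain μ := fun z hz =>
    laplaceDomain_mono hθ₀ (by simpa using hz)
  obtain ⟨b₀, hb₀⟩ := exists_norm_laplace_le hθ₀
  set b : ℝ := 1 + |b₀| with hb
  have hb1 : 1 ≤ b := by rw [hb]; linarith [abs_nonneg b₀]
  have hX : ∀ z : ℂ, θ₀ ≤ z.re → ∀ i j, ‖(1 - laplace μ z) i j‖ ≤ b := by
    intro z hz i j
    rw [Matrix.sub_apply]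
    refine (norm_sub_le _ _).trans (add_le_add ?_ ((hb₀ z hz i j).trans (le_abs_self _)))
    rw [Matrix.one_apply]; split_ifs <;> simp
  obtain ⟨hinv, B₁, hB₁⟩ := hres
  obtain ⟨δ₁, hδ₁, hline₁⟩ := exists_lower_bound_det (ι := ℝ)
    (X := fun η => 1 - laplace μ ((θ : ℂ) + (η : ℂ) * Complex.I))
    (R := fun η => laplaceResolvent μ ((θ : ℂ) + (η : ℂ) * Complex.I)) (b := B₁)
    (fun η => Matrix.mul_nonsing_inv _ (isUnit_iff_ne_zero.mpr (hinv η)))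
    (fun η i j => (norm_entry_le i j).trans (hB₁ ⟨η, rfl⟩))
  obtain ⟨B₂, hB₂⟩ := exists_norm_laplace_le hc
  obtain ⟨δ₂, hδ₂, hline₂⟩ := exists_lower_bound_det (ι := ℝ)
    (X := fun η => 1 - laplace μ ((c : ℂ) + (η : ℂ) * Complex.I))
    (R := fun η => laplace (renewalMeasure μ) ((c : ℂ) + (η : ℂ) * Complex.I)) (b := B₂)
    (fun η => one_sub_laplace_mul_laplace_renewalMeasure (hdom _ (by simp; linarith))
      (laplaceDomain_mono hc (by simp)))
    (fun η i j => hB₂ _ (by simp) i j)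
  obtain ⟨r, hr0, hrρ, hrθ, hne, T, δ', hδ', hlow⟩ := exists_strip_lower_bound
    (f := fun z => (1 - laplace μ z).det) (M := p.factorial * b ^ p) (δ := min δ₁ δ₂) h0 hθc
    (lt_min hδ₁ hδ₂) hρ
    (fun z hz => (analyticAt_det (analyticAt_one_sub_laplace
      (analyticAt_laplace hθ₀ hz))).differentiableAt.differentiableWithinAt)
    (fun z hz => norm_det_le (hX z hz.le))
    (fun η => (min_le_left _ _).trans (hline₁ η)) (fun η => (min_le_right _ _).trans (hline₂ η))
    (hfin.subset fun z hz => ⟨⟨hdom z (h0.le.trans hz.2.le), hz.1⟩, hz.2⟩)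
  refine ⟨r, hr0, hrρ, hrθ, hne, T, δ'⁻¹ * (p.factorial * b ^ p), fun z h1 h2 h3 i j => ?_⟩
  rw [laplaceResolvent_eq, Matrix.smul_apply, smul_eq_mul, norm_mul, norm_inv]
  gcongr
  · exact hlow z h1 h2 h3
  · exact norm_adjugate_le hb1 (hX z (hrθ.le.trans h1)) i j

end Resolvent

end MarkovRenewal

namespace MarkovRenewal

/-! ### The expansion from the principal parts -/

section Expansion

variable {p : ℕ}

open Complex in
/-- A bound of order `|Im z|⁻¹` on a vertical strip for an analytic function which satisfies it
outside of a compact set. -/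
theorem exists_strip_decay {D : ℂ → ℂ} {a c C T : ℝ}
    (hD : ContinuousOn D {z | a ≤ z.re ∧ z.re ≤ c})
    (hbd : ∀ z : ℂ, a ≤ z.re → z.re ≤ c → T ≤ |z.im| →
      ‖D z‖ ≤ C * (1 + z.im ^ 2) ^ (-1 / 2 : ℝ)) :
    ∃ C' : ℝ, ∀ z : ℂ, a ≤ z.re → z.re ≤ c → ‖D z‖ ≤ C' * (1 + z.im ^ 2) ^ (-1 / 2 : ℝ) := by
  have hK : IsCompact (Set.Icc a c ×ℂ Set.Icc (-T) T) := isCompact_Icc.reProdIm isCompact_Icc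
  obtain ⟨B, hB⟩ := hK.exists_bound_of_continuousOn (f := D) (hD.mono fun z hz => hz.1)
  refine ⟨max C (|B| * (1 + T ^ 2) ^ (1 / 2 : ℝ)), fun z h1 h2 => ?_⟩
  rcases le_total T |z.im| with h | h
  · exact (hbd z h1 h2 h).trans (by gcongr; exact le_max_left _ _)
  · have h3 : (1 : ℝ) ≤ (1 + T ^ 2) ^ (1 / 2 : ℝ) * (1 + z.im ^ 2) ^ (-1 / 2 : ℝ) := by
      rw [neg_div, Real.rpow_neg (by positivity), ← div_eq_mul_inv, one_le_div (by positivity)]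
      have : z.im ^ 2 ≤ T ^ 2 := by rw [← sq_abs z.im]; gcongr
      gcongr
    calc ‖D z‖ ≤ |B| := (hB z ⟨⟨h1, h2⟩, abs_le.mp h⟩).trans (le_abs_self B)
      _ ≤ |B| * ((1 + T ^ 2) ^ (1 / 2 : ℝ) * (1 + z.im ^ 2) ^ (-1 / 2 : ℝ)) :=
        le_mul_of_one_le_right (abs_nonneg B) h3
      _ = |B| * (1 + T ^ 2) ^ (1 / 2 : ℝ) * (1 + z.im ^ 2) ^ (-1 / 2 : ℝ) := by ring
      _ ≤ _ := by gcongr; exact le_max_right _ _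

open Complex in
/-- Expansion of the renewal function from the principal parts of `(1 - ℒμ(z))⁻¹ / z` at a finite
set of poles. -/
theorem renewalFunction_expansion {μ : MeasureMatrix p} [∀ i j, SFinite (μ i j)]
    {θ₀ a c θ T B : ℝ} (hθ₀ : (θ₀ : ℂ) ∈ laplaceDomain μ) (h0a : θ₀ < a) (haθ : a < θ) (hθc : θ < c)
    (hc0 : 0 < c) (hc : (c : ℂ) ∈ laplaceDomain (renewalMeasure μ))
    (hU : ∀ (t : ℝ) (i j : Fin p), renewalFunction μ t i j < ∞) (i j : Fin p)
    (hB : ∀ z : ℂ, a ≤ z.re → z.re ≤ c → T ≤ |z.im| → ‖laplaceResolvent μ z i j‖ ≤ B)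
    (P : Finset ℂ) (N : ℂ → ℕ) (b : ℂ → ℕ → ℂ)
    (hreg : ∀ z : ℂ, a ≤ z.re → z ∉ P → z ≠ 0 ∧ (1 - laplace μ z).det ≠ 0)
    (hPc : ∀ z ∈ P, z.re < c)
    (hpole : ∀ z ∈ P, a ≤ z.re → ∃ g : ℂ → ℂ, AnalyticAt ℂ g z ∧ ∀ᶠ w in 𝓝[≠] z,
      laplaceResolvent μ w i j / w =
        ∑ k ∈ Finset.range (N z), b z k * (k.factorial / (w - z) ^ (k + 1)) + g w) :
    (fun t : ℝ => (((renewalFunction μ t i j).toReal : ℝ) : ℂ) -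
      ∑ l ∈ P, ∑ k ∈ Finset.range (N l), b l k * ((t : ℂ) ^ k * cexp (l * t)))
      =O[atTop] fun t : ℝ => Real.exp (θ * t) := by
  set m : ℝ → ℂ := fun t =>
    ∑ l ∈ P, ∑ k ∈ Finset.range (N l), b l k * ((t : ℂ) ^ k * cexp (l * t)) with hmdef
  set q : ℂ → ℂ → ℂ := fun l z =>
    ∑ k ∈ Finset.range (N l), b l k * (k.factorial / (z - l) ^ (k + 1)) with hq
  have hm : HasRegularTransform c m fun z => ∑ l ∈ P, q l z :=
    HasRegularTransform.sum P fun l hl => HasRegularTransform.sum _ fun k _ =>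
      (hasRegularTransform_pow_mul_exp (hPc l hl) k).const_mul _
  have hqa : ∀ l z : ℂ, z ≠ l → AnalyticAt ℂ (q l) z := by
    intro l z hz
    refine Finset.analyticAt_fun_sum _ fun k _ => analyticAt_const.mul (analyticAt_const.div
      ((analyticAt_id.sub analyticAt_const).pow _) (pow_ne_zero _ (sub_ne_zero.mpr hz)))
  have hac : a ≤ c := (haθ.trans hθc).le
  -- Near a pole in `P` its own principal part cancels, while those of the other poles are analytic
  -- there; the singularities are removable.
  obtain ⟨D, hDa, hDf⟩ := exists_analytic_extension
    (f := fun z => laplaceResolvent μ z i j / z - ∑ l ∈ P, q l z) (Ω := {z | a ≤ z.re}) (S := P)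
    (by
      intro z hz hzP
      obtain ⟨hz0, hdet⟩ := hreg z hz hzP
      refine ((analyticAt_laplaceResolvent (analyticAt_laplace hθ₀ (h0a.trans_le hz)) hdet i j).div
        analyticAt_id hz0).sub (Finset.analyticAt_fun_sum _ fun l hl => hqa l z ?_)
      rintro rfl
      exact hzP hl)
    (by
      intro z hz hzP
      obtain ⟨g, hg, hgw⟩ := hpole z hzP hz
      refine ⟨fun w => g w - ∑ l ∈ P.erase z, q l w, hg.sub (Finset.analyticAt_fun_sum _
        fun l hl => hqa l z (Finset.ne_of_mem_erase hl).symm), ?_⟩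
      filter_upwards [hgw] with w hw
      rw [hw, ← Finset.add_sum_erase P _ hzP]
      simp only [hq]
      ring)
  have hDdiff : DifferentiableOn ℂ D {z | a ≤ z.re ∧ z.re ≤ c} := fun z hz =>
    (hDa z hz.1).differentiableAt.differentiableWithinAt
  obtain ⟨CQ, TQ, hQ⟩ := hm.decay
  -- Above the heights of `P` the extension `D` is given by the original formula, so the resolvent
  -- bound applies.
  obtain ⟨TP, hTP⟩ := (P.finite_toSet.image fun z => |z.im|).bddAbove
  obtain ⟨C, hC⟩ := exists_strip_decay (D := D) (a := a) (c := c)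
    (T := max (max T TQ) (max 1 (TP + 1))) (C := |B| * 2 + CQ) hDdiff.continuousOn (by
      intro z h1 h2 h3
      have hT : T ≤ |z.im| := ((le_max_left _ _).trans (le_max_left _ _)).trans h3
      have hTQ : TQ ≤ |z.im| := ((le_max_right _ _).trans (le_max_left _ _)).trans h3
      have h1' : 1 ≤ |z.im| := ((le_max_left _ _).trans (le_max_right _ _)).trans h3
      have hTP' : TP + 1 ≤ |z.im| := ((le_max_right _ _).trans (le_max_right _ _)).trans h3
      have hzP : z ∉ P := fun h => by
        have := hTP (Set.mem_image_of_mem (fun z : ℂ => |z.im|) (Finset.mem_coe.mpr h))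
        linarith
      rw [hDf z hzP, add_mul]
      refine (norm_sub_le _ _).trans (add_le_add ?_ (hQ z hTQ))
      rw [norm_div, div_eq_mul_inv, mul_assoc]
      have hinv : ‖z‖⁻¹ ≤ |z.im|⁻¹ := inv_anti₀ (by linarith) (abs_im_le_norm z)
      have hR := (hB z h1 h2 hT).trans (le_abs_self B)
      have h2' := inv_abs_le_rpow h1'
      gcongr
      exact hinv.trans h2')
  have hcz : ∀ z : ℂ, z.re = c → z ∈ laplaceDomain (renewalMeasure μ) := fun z hz =>
    laplaceDomain_mono hc (by simp [hz])
  have hres : ∀ z : ℂ, z.re = c → laplaceResolvent μ z = laplace (renewalMeasure μ) z := fun z hz =>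
    Matrix.inv_eq_right_inv (one_sub_laplace_mul_laplace_renewalMeasure
      (laplaceDomain_mono hθ₀ (by simp [hz]; linarith)) (hcz z hz))
  have hlap : ∀ z : ℂ, z.re = c → _ := fun z hz =>
    laplace_renewalFunction (μ := μ) (z := z) (by rw [hz]; exact hc0) (hcz z hz) i j
  obtain ⟨Bm, K, -, hgrowth⟩ := hm.growth
  refine tauberian (u := fun t => (renewalFunction μ t i j).toReal) (m := m) (D := D) haθ hac
    ((monotone_renewalFunction hU i j).monotoneOn _) (fun t => ENNReal.toReal_nonneg)
    hm.differentiable (fun t ht => (hgrowth t ht).1) (fun t ht => (hgrowth t ht).2) ?_ hDdiff hC ?_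
  · simp_rw [mul_sub]
    exact (hlap c (by simp)).1.sub (hm.integrable c (by simp))
  · intro η
    have hre : ((c : ℂ) + η * I).re = c := by simp
    have hzP : (c : ℂ) + η * I ∉ P := fun h => by
      have := hPc _ h
      rw [hre] at this
      exact lt_irrefl _ this
    simp_rw [mul_sub]
    rw [integral_sub (hlap _ hre).1 (hm.integrable _ hre), (hlap _ hre).2, hm.transform _ hre,
      hDf _ hzP, hres _ hre]

end Expansion

end MarkovRenewal

/-! ### The main theorem -/

open MarkovRenewal in
theorem mainTheorem1 {p : ℕ} (μ : MeasureMatrix p)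
    (hμ : ∀ i j, IsLocallyFiniteMeasure (μ i j))
    (ϑ : ℝ) (hA1 : (ϑ : ℂ) ∈ interior (laplaceDomain μ))
    (hA2 : spectralRadius ℂ (massAtZero μ) < 1)
    (hres : ResolventBoundedOnLine μ ϑ)
    (hfin : (rootsAbove μ ϑ).Finite) :
    -- the renewal function is finite
    (∀ (t : ℝ) (i j : Fin p), renewalFunction μ t i j < ∞) ∧
    ∃ (A C : ℂ → ℕ → Matrix (Fin p) (Fin p) ℂ) (C₀ : Matrix (Fin p) (Fin p) ℝ),
      -- `A l k` is the coefficient of `(z - l)^{-k}` in the Laurent series of `(I - ℒμ)⁻¹` at `l`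
      (∀ l ∈ rootsAbove μ ϑ, IsLaurentExpansion (laplaceResolvent μ) l (poleOrder μ l) (A l)) ∧
      -- the coefficients at the nonzero roots
      (∀ l ∈ rootsAbove μ ϑ, l ≠ 0 → ∀ k < poleOrder μ l,
        C l k = ((k.factorial : ℂ))⁻¹ • ∑ n ∈ Finset.range (poleOrder μ l - k),
          ((-1 : ℂ) ^ n / l ^ (n + 1)) • A l (n + k + 1)) ∧
      -- the coefficients at zero, when zero lies to the right of `ϑ`
      (ϑ < 0 →
        IsLaurentExpansion (laplaceResolvent μ) 0 (poleOrder μ 0) (A 0) ∧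
        (∀ k < poleOrder μ 0, C 0 k = ((k.factorial : ℂ))⁻¹ • A 0 k) ∧
        C₀.map (fun x : ℝ => (x : ℂ)) =
          (((poleOrder μ 0).factorial : ℂ))⁻¹ • A 0 (poleOrder μ 0)) ∧
      -- conjugate symmetry of the coefficients
      (∀ l ∈ rootsAbove μ ϑ, ∀ k < poleOrder μ l,
        C (starRingEnd ℂ l) k = (C l k).map (starRingEnd ℂ)) ∧
      -- the asymptotic expansion, entry by entry
      ∀ i j : Fin p,
        (fun t : ℝ => (((renewalFunction μ t i j).toReal : ℝ) : ℂ) -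
            ((∑ l ∈ hfin.toFinset, Complex.exp (l * (t : ℂ)) *
                ∑ k ∈ Finset.range (poleOrder μ l), (t : ℂ) ^ k * C l k i j) +
              (t : ℂ) ^ poleOrder μ 0 * ((C₀ i j : ℝ) : ℂ)))
          =O[atTop] fun t : ℝ => t * Real.exp (ϑ * t) := by

  have hsf : ∀ i j, SFinite (μ i j) := fun i j => by
    have := hμ i j
    infer_instance
  -- the abscissa `θ₀` to the left of `ϑ`
  obtain ⟨θ₀, hθ₀ϑ, hθ₀⟩ : ∃ θ₀ : ℝ, θ₀ < ϑ ∧ (θ₀ : ℂ) ∈ laplaceDomain μ := by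
    obtain ⟨ε, hε, hball⟩ := Metric.mem_nhds_iff.mp (mem_interior_iff_mem_nhds.mp hA1)
    refine ⟨ϑ - ε / 2, by linarith, hball ?_⟩
    rw [Metric.mem_ball, Complex.dist_eq, ← Complex.ofReal_sub, Complex.norm_real, Real.norm_eq_abs,
      sub_sub_cancel_left, abs_neg, abs_of_pos (by linarith)]
    linarith
  have hdom : ∀ z : ℂ, θ₀ ≤ z.re → z ∈ laplaceDomain μ := fun z hz =>
    laplaceDomain_mono hθ₀ (by simpa using hz)
  obtain ⟨s, hs0, -, hs⟩ := exists_mem_laplaceDomain_renewalMeasure hθ₀ hA2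
  have hU : ∀ (t : ℝ) (i j : Fin p), renewalFunction μ t i j < ∞ := renewalFunction_lt_top hs0 hs
  refine ⟨hU, ?_⟩
  -- a line `Re z = c` to the right of everything
  obtain ⟨b, hb⟩ := (hfin.image Complex.re).bddAbove
  set c : ℝ := max s (max ϑ b) + 1 with hcdef
  have hsc : s < c := by rw [hcdef]; linarith [le_max_left s (max ϑ b)]
  have hϑc : ϑ < c := by
    rw [hcdef]; linarith [le_max_right s (max ϑ b), le_max_left ϑ b]
  have hΛc : ∀ z ∈ rootsAbove μ ϑ, z.re < c := fun z hz => by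
    have := hb (Set.mem_image_of_mem _ hz)
    rw [hcdef]; linarith [le_max_right s (max ϑ b), le_max_right ϑ b]
  have hcU : (c : ℂ) ∈ laplaceDomain (renewalMeasure μ) :=
    laplaceDomain_mono hs (by simpa using hsc.le)
  -- For `ϑ > 0` the choice `ρ = ϑ/2` forces `a > 0`, which keeps the pole of `1/z` out of the
  -- strip.
  obtain ⟨r, hr0, hrρ, hrθ, hne, T, B, hB⟩ := exists_resolvent_bound
    (ρ := if 0 < ϑ then ϑ / 2 else 1) hθ₀ hθ₀ϑ hϑc (by split_ifs <;> linarith) hcU hres hfin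
  set a : ℝ := ϑ - r with ha
  have haϑ : a < ϑ := by linarith
  have hreg : ∀ z : ℂ, a ≤ z.re → z ∉ rootsAbove μ ϑ → (1 - laplace μ z).det ≠ 0 := by
    intro z hz hzΛ hdet
    rcases le_or_gt z.re ϑ with h | h
    · exact hne z (by rw [abs_le]; constructor <;> linarith) hdet
    · exact hzΛ ⟨⟨hdom z (by linarith), hdet⟩, h⟩
  -- Laurent expansions
  obtain ⟨A, hA, hAconj⟩ := exists_symmetric_laurent (μ := μ) (S := {z | a ≤ z.re})
    (fun l hl => by simpa using hl) (by
      intro l hl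
      have han := analyticAt_laplace hθ₀ (lt_of_lt_of_le hrθ hl)
      refine exists_isLaurentExpansion_laplaceResolvent (hdom l (hrθ.le.trans hl)) han ?_
      rcases le_or_gt l.re ϑ with h | h
      · have h1 := hne l (by rw [abs_le]; have : a ≤ l.re := hl; constructor <;> linarith)
        exact ((analyticAt_det (analyticAt_one_sub_laplace han)).continuousAt.eventually_ne
          h1).filter_mono nhdsWithin_le_nhds
      · have h1 : ((rootsAbove μ ϑ) \ {l})ᶜ ∈ 𝓝 l :=
          (hfin.subset Set.sdiff_subset).isClosed.isOpen_compl.mem_nhds (by simp)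
        have h2 : ∀ᶠ w : ℂ in 𝓝 l, ϑ < w.re :=
          Complex.continuous_re.continuousAt.eventually (lt_mem_nhds h)
        filter_upwards [mem_nhdsWithin_of_mem_nhds h1, self_mem_nhdsWithin,
          h2.filter_mono nhdsWithin_le_nhds] with w hw hwl hwϑ
        exact hreg w (by linarith) fun hwΛ => hw ⟨hwΛ, hwl⟩)
  set κ := poleOrder μ with hκ
  set C : ℂ → ℕ → Matrix (Fin p) (Fin p) ℂ := fun l k =>
    if l = 0 then ((k.factorial : ℂ))⁻¹ • A 0 k
    else ((k.factorial : ℂ))⁻¹ • ∑ n ∈ Finset.range (κ l - k),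
      ((-1 : ℂ) ^ n / l ^ (n + 1)) • A l (n + k + 1) with hC
  have hC0 : ∀ k, C 0 k = ((k.factorial : ℂ))⁻¹ • A 0 k := fun k => if_pos rfl
  have hCne : ∀ l, l ≠ 0 → ∀ k, C l k = ((k.factorial : ℂ))⁻¹ • ∑ n ∈ Finset.range (κ l - k),
      ((-1 : ℂ) ^ n / l ^ (n + 1)) • A l (n + k + 1) := fun l hl k => if_neg hl
  -- For `ϑ > 0` any power of `t` is absorbed in the remainder, so `0` will do. For `ϑ ≤ 0` the
  -- point `0` lies in the strip, also if `ϑ = 0`, since `a < ϑ`.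
  set C₀ : Matrix (Fin p) (Fin p) ℝ :=
    if 0 < ϑ then 0 else Matrix.of fun i j => (C 0 (κ 0) i j).re with hC₀
  -- `0` is its own conjugate, so the symmetric choice of `A` makes its coefficients real.
  have hreal : ∀ k i j, (((C 0 k i j).re : ℝ) : ℂ) = C 0 k i j := by
    intro k i j
    have h1 := congrFun (congrFun (hAconj 0 k) i) j
    rw [map_zero, Matrix.map_apply] at h1
    apply Complex.conj_eq_iff_re.mp
    rw [hC0, Matrix.smul_apply, smul_eq_mul, map_mul, ← h1, map_inv₀, map_natCast]
  refine ⟨A, C, C₀, fun l hl => hA l (haϑ.le.trans hl.2.le), fun l _ hl0 k _ => hCne l hl0 k,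
    fun hϑ => ⟨hA 0 (by simp; linarith), fun k _ => hC0 k, ?_⟩, ?_, fun i j => ?_⟩
  · rw [hC₀, if_neg (by linarith), ← hC0]
    ext i j
    exact hreal _ i j
  · intro l hl k hk
    by_cases hl0 : l = 0
    · subst hl0
      ext i j
      rw [map_zero, Matrix.map_apply, ← hreal k i j, Complex.conj_ofReal]
    · rw [hCne l hl0, hCne _ (by simpa using hl0), hκ, poleOrder_conj]
      ext i j
      simp [Matrix.sum_apply, hAconj]
  -- the principal parts of the resolvent divided by `z`
  have hpole : ∀ z : ℂ, a ≤ z.re → ∃ g : ℂ → ℂ, AnalyticAt ℂ g z ∧ ∀ᶠ w in 𝓝[≠] z,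
      laplaceResolvent μ w i j / w = ∑ k ∈ Finset.range (if z = 0 then κ z + 1 else κ z),
        C z k i j * (k.factorial / (w - z) ^ (k + 1)) + g w := by
    intro z hz
    have hfac : ∀ k : ℕ, (k.factorial : ℂ) ≠ 0 := fun k => by exact_mod_cast k.factorial_ne_zero
    by_cases hz0 : z = 0
    · subst hz0
      obtain ⟨g, hg, hgw⟩ := (hA 0 hz).div_self_zero i j
      refine ⟨g, hg, ?_⟩
      filter_upwards [hgw] with w hw
      rw [hw, if_pos rfl, sub_zero]
      congr 1
      refine Finset.sum_congr rfl fun k _ => ?_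
      rw [hC0, Matrix.smul_apply, smul_eq_mul]
      field_simp [hfac k]
    · obtain ⟨g, hg, hgw⟩ := (hA z hz).div_self_of_ne_zero hz0 i j
      refine ⟨g, hg, ?_⟩
      filter_upwards [hgw] with w hw
      rw [hw, if_neg hz0]
      congr 1
      refine Finset.sum_congr rfl fun k _ => ?_
      rw [hCne z hz0, Matrix.smul_apply, Matrix.sum_apply, smul_eq_mul]
      simp only [Matrix.smul_apply, smul_eq_mul]
      field_simp [hfac k]
  -- The argument yields `O(e^{ϑt})`, which is stronger than the stated remainder.
  have hO : (fun t : ℝ => Real.exp (ϑ * t)) =O[atTop] fun t : ℝ => t * Real.exp (ϑ * t) := by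
    refine IsBigO.of_bound 1 ?_
    filter_upwards [eventually_ge_atTop 1] with t ht
    rw [one_mul, Real.norm_of_nonneg (by positivity), Real.norm_of_nonneg (by positivity)]
    exact le_mul_of_one_le_left (by positivity) ht
  have hsum : ∀ (t : ℝ) (l : ℂ), Complex.exp (l * (t : ℂ)) *
      ∑ k ∈ Finset.range (κ l), (t : ℂ) ^ k * C l k i j =
      ∑ k ∈ Finset.range (κ l), C l k i j * ((t : ℂ) ^ k * Complex.exp (l * t)) := by
    intro t l
    rw [Finset.mul_sum]
    exact Finset.sum_congr rfl fun k _ => by ring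
  have hexp := fun P => renewalFunction_expansion hθ₀ hrθ haϑ hϑc (hs0.trans_lt hsc) hcU hU i j
    (fun z h1 h2 h3 => hB z h1 h2 h3 i j) P (fun l => if l = 0 then κ l + 1 else κ l)
    fun l k => C l k i j
  by_cases hϑ : 0 < ϑ
  · rw [if_pos hϑ] at hrρ
    have ha0 : 0 < a := by linarith
    have hne0 : ∀ z : ℂ, a ≤ z.re → z ≠ 0 := by
      rintro z hz rfl
      rw [Complex.zero_re] at hz
      linarith
    refine IsBigO.trans ?_ hO
    refine (hexp hfin.toFinset (fun z hz hzP => ⟨hne0 z hz, hreg z hz (by simpa using hzP)⟩)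
      (fun z hz => hΛc z (by simpa using hz)) fun z _ hz => hpole z hz).congr_left fun t => ?_
    rw [hC₀, if_pos hϑ]
    simp only [Matrix.zero_apply, Complex.ofReal_zero, mul_zero, add_zero]
    congr 1
    refine Finset.sum_congr rfl fun l hl => ?_
    rw [hsum, if_neg (hne0 l (haϑ.le.trans ((hfin.mem_toFinset.mp hl).2.le)))]
  · have h0root : (0 : ℂ) ∉ hfin.toFinset → κ 0 = 0 := by
      intro h
      rw [hκ, poleOrder, if_neg]
      intro hroot
      exact hreg 0 (by simp; linarith) (by simpa using h) hroot.2
    refine IsBigO.trans ?_ hO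
    -- If `0` is not a root it still is a possible pole because of `1/z`; then `κ 0 = 0` and it
    -- contributes only the constant `C₀`. If it is a root, the insertion changes nothing.
    refine (hexp (insert 0 hfin.toFinset) (fun z hz hzP => ?_) (fun z hz => ?_)
      fun z _ hz => hpole z hz).congr_left fun t => ?_
    · rw [Finset.mem_insert, not_or] at hzP
      exact ⟨hzP.1, hreg z hz (by simpa using hzP.2)⟩
    · rcases Finset.mem_insert.mp hz with rfl | hz
      · simpa using hs0.trans_lt hsc
      · exact hΛc z (by simpa using hz)
    · congr 1
      -- At `0` the range is longer by one; its last index `k = κ 0` is the separate term of the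
      -- statement.
      have h1 : ∀ l : ℂ, ∑ k ∈ Finset.range (if l = 0 then κ l + 1 else κ l),
          C l k i j * ((t : ℂ) ^ k * Complex.exp (l * t)) =
          Complex.exp (l * (t : ℂ)) * ∑ k ∈ Finset.range (κ l), (t : ℂ) ^ k * C l k i j +
            if l = 0 then (t : ℂ) ^ κ 0 * ((C₀ i j : ℝ) : ℂ) else 0 := by
        intro l
        rw [hsum]
        split_ifs with hl
        · subst hl
          rw [Finset.sum_range_succ, hC₀, if_neg hϑ, Matrix.of_apply, hreal]
          simp [mul_comm]
        · rw [add_zero]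
      simp_rw [h1]
      rw [Finset.sum_add_distrib, Finset.sum_ite_eq' (insert 0 hfin.toFinset),
        if_pos (Finset.mem_insert_self _ _), Finset.sum_insert_of_eq_zero_if_notMem]
      intro h
      rw [h0root h]
      simp
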